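/- Let $\Gamma=\mathrm{PSL}_2(\mathbb Z)$ and let $n\ge 1$ be an integer. Let $\mathcal M_n$ be the set of $2\times 2$ integer matrices of determinant $n$, modulo $\{\pm 1\}$; $\Gamma$ acts on it by left multiplication and by conjugation. For $M\in\mathcal M_n$ let $\Gamma_M$ be its centralizer in $\Gamma$, and define the weight $w(M)\in\mathbb Q$ by: $w(M)=1/6$ if $M$ is scalar; $w(M)=-1/|\Gamma_M|$ if $M$ is elliptic ($\operatorname{tr}(M)^2<4n$); $w(M)=1$ if $M$ is split hyperbolic ($\operatorname{tr}(M)^2-4n$ a positive square); and $w(M)=0$ otherwise (non-split hyperbolic or parabolic). It depends only on the $\Gamma$-conjugacy class $X$ of $M$ and is also written $w(X)$. For $D>0$ let $H(D)$ be the number of $\Gamma$-equivalence classes of positive definite integral binary quadratic forms $ax^2+bxy+cy^2$ of discriminant $b^2-4ac=-D$, where the classes containing a multiple of $x^2+y^2$, respectively of $x^2-xy+y^2$, are counted with multiplicity $1/2$, respectively $1/3$. Put $H(0)=-1/12$, $H(-u^2)=-u/2$ for integers $u>0$, and $H(D)=0$ for all other $D<0$. Then the following hold (the Kronecker–Hurwitz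 class number relation). (1) The set $\Gamma\backslash\mathcal M_n$ is finite, $w(X)\neq 0$ for only finitely many $\Gamma$-conjugacy classes $X\subset\mathcal M_n$, and $$\sum_{X\subset\mathcal M_n} w(X)=-\,|\Gamma\backslash\mathcal M_n| .$$ (2) For every $t\in\mathbb Z$ (the number of classes of forms counted by $H(4n-t^2)$ being finite if $t^2<4n$), $$\sum_{X\subset\mathcal M_n,\ \operatorname{tr}(X)=\pm t} w(X)=\begin{cases}-2H(4n-t^2)&\text{if }t\neq 0,\\ -H(4n-t^2)&\text{if }t=0.\end{cases}$$ (3) Equivalently to (1), by (2): $H(4n-t^2)\ne 0$ for only finitely many $t\in\mathbb Z$, and $$\sum_{t\in\mathbb Z}H(4n-t^2)=\sigma_1(n)=\sum_{d\mid n}d .$$ (4) In classical form, $$\sum_{t\in\mathbb Z,\ t^2\le 4n}H(4n-t^2)=\sum_{n=ad,\ a,d>0}\max(a,d).$$ -/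

import Mathlib

open scoped MatrixGroups

noncomputable section

namespace KroneckerHurwitz

/-- The modular group `PSL₂(ℤ)`. -/
abbrev Gam : Type := PSL(2, ℤ)

/-- The congruence on the monoid of `2 × 2` integer matrices that identifies `A` with `-A`. -/
def signCon : Con (Matrix (Fin 2) (Fin 2) ℤ) where
  r A B := A = B ∨ A = -B
  iseqv :=
    { refl := fun _ => Or.inl rfl
      symm := by
        rintro A B (rfl | rfl)
        · exact Or.inl rfl
        · exact Or.inr (neg_neg B).symm
      trans := by
        rintro A B C (rfl | rfl) (rfl | rfl)
        · exact Or.inl rfl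
        · exact Or.inr rfl
        · exact Or.inr rfl
        · exact Or.inl (neg_neg C) }
  mul' := by
    rintro A B C D (rfl | rfl) (rfl | rfl)
    · exact Or.inl rfl
    · exact Or.inr (mul_neg _ _)
    · exact Or.inr (neg_mul _ _)
    · exact Or.inl (neg_mul_neg _ _)

/-- The monoid of `2 × 2` integer matrices modulo `{± 1}`. -/
abbrev PMat : Type := signCon.Quotient

/-- The determinant, which is well defined modulo sign since the size of the matrices is even. -/
def PMat.det (x : PMat) : ℤ :=
  Con.liftOn x (fun A => A.det) (by
    rintro A B (rfl | rfl)
    · rfl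
    · simp [Matrix.det_fin_two])

/-- The square of the trace, which is well defined modulo sign. -/
def PMat.trSq (x : PMat) : ℤ :=
  Con.liftOn x (fun A => A.trace ^ 2) (by
    rintro A B (rfl | rfl)
    · rfl
    · simp)

/-- The class modulo sign of a scalar matrix. -/
def PMat.IsScalar (x : PMat) : Prop :=
  ∃ a : ℤ, x = ((Matrix.scalar (Fin 2) a : Matrix (Fin 2) (Fin 2) ℤ) : PMat)

/-- The inclusion `± γ ↦ ± γ` of the modular group in the monoid of integer matrices modulo
sign. -/
def toPMat : Gam →* PMat :=
  QuotientGroup.lift (Subgroup.center SL(2, ℤ))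
    (signCon.mk'.comp Matrix.SpecialLinearGroup.coeMonoidHom) (by
      intro A hA
      obtain ⟨r, hr, hA'⟩ := Matrix.SpecialLinearGroup.mem_center_iff.mp hA
      refine (Con.eq signCon).mpr ?_
      change (A : Matrix (Fin 2) (Fin 2) ℤ) = 1 ∨ (A : Matrix (Fin 2) (Fin 2) ℤ) = -1
      rw [← hA']
      rw [Fintype.card_fin] at hr
      rcases (show r = 1 ∨ r = -1 from by simpa using hr) with rfl | rfl
      · left; simp
      · right; simp)

theorem PMat.det_mul (x y : PMat) : (x * y).det = x.det * y.det := by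
  induction x, y using Con.induction_on₂ with
  | _ A B => exact Matrix.det_mul A B

theorem det_toPMat (g : Gam) : (toPMat g).det = 1 := by
  induction g using QuotientGroup.induction_on with
  | _ A => exact A.det_coe

theorem PMat.trSq_conj (g : Gam) (x : PMat) :
    (toPMat g * x * toPMat g⁻¹).trSq = x.trSq := by
  induction g using QuotientGroup.induction_on with
  | _ A =>
    induction x using Con.induction_on with
    | _ B =>
      change ((A : Matrix (Fin 2) (Fin 2) ℤ) * B * ((A⁻¹ : SL(2, ℤ)) :
        Matrix (Fin 2) (Fin 2) ℤ)).trace ^ 2 = B.trace ^ 2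
      rw [Matrix.trace_mul_comm, ← mul_assoc, ← Matrix.SpecialLinearGroup.coe_mul,
        inv_mul_cancel, Matrix.SpecialLinearGroup.coe_one, one_mul]

/-- The set of integer matrices of determinant `n` modulo `{± 1}`. -/
abbrev HMat (n : ℕ) : Type := {x : PMat // x.det = n}

/-- The modular group acts on the matrices of determinant `n` by left multiplication. -/
instance leftMul (n : ℕ) : MulAction Gam (HMat n) where
  smul g x := ⟨toPMat g * x.1, by rw [PMat.det_mul, det_toPMat, x.2, one_mul]⟩
  one_smul x := Subtype.ext (by
    change toPMat 1 * x.1 = x.1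
    rw [map_one, one_mul])
  mul_smul g h x := Subtype.ext (by
    change toPMat (g * h) * x.1 = toPMat g * (toPMat h * x.1)
    rw [map_mul, mul_assoc])

/-- The quotient of the matrices of determinant `n` by the left multiplication action of the
modular group. -/
abbrev LeftQuot (n : ℕ) : Type := MulAction.orbitRel.Quotient Gam (HMat n)

/-- Conjugacy under the modular group. -/
def conjSetoid (n : ℕ) : Setoid (HMat n) where
  r x y := ∃ g : Gam, y.1 = toPMat g * x.1 * toPMat g⁻¹
  iseqv :=
    { refl := fun x => ⟨1, by simp⟩
      symm := by
        rintro x y ⟨g, hg⟩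
        refine ⟨g⁻¹, ?_⟩
        rw [hg, inv_inv]
        simp only [← mul_assoc, ← map_mul]
        rw [mul_assoc, ← map_mul]
        simp
      trans := by
        rintro x y z ⟨g, hg⟩ ⟨h, hh⟩
        refine ⟨h * g, ?_⟩
        rw [hh, hg, mul_inv_rev, map_mul, map_mul]
        simp only [mul_assoc] }

/-- The conjugacy classes, under the modular group, of matrices of determinant `n`. -/
abbrev ConjClass (n : ℕ) : Type := Quotient (conjSetoid n)

/-- The centralizer of a matrix in the modular group. -/
def centralizer (x : PMat) : Subgroup Gam where
  carrier := {g | toPMat g * x = x * toPMat g}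
  one_mem' := by simp
  mul_mem' := by
    intro g h hg hh
    change toPMat (g * h) * x = x * toPMat (g * h)
    change toPMat g * x = x * toPMat g at hg
    change toPMat h * x = x * toPMat h at hh
    rw [map_mul, mul_assoc, hh, ← mul_assoc, hg, mul_assoc]
  inv_mem' := by
    intro g hg
    change toPMat g⁻¹ * x = x * toPMat g⁻¹
    change toPMat g * x = x * toPMat g at hg
    calc toPMat g⁻¹ * x = toPMat g⁻¹ * (x * toPMat g) * toPMat g⁻¹ := by
          rw [mul_assoc, mul_assoc, ← map_mul, mul_inv_cancel, map_one, mul_one]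
      _ = x * toPMat g⁻¹ := by
          rw [← hg, ← mul_assoc, ← map_mul, inv_mul_cancel, map_one, one_mul]

open Classical in
/-- The weight of a matrix: `1/6` for a scalar matrix, `-1/|Γ_M|` for an elliptic one
(`tr² < 4 det`), `1` for a split hyperbolic one (`tr² - 4 det` a positive square), and `0` for the
remaining ones (non-split hyperbolic or parabolic). -/
def weight (x : PMat) : ℚ :=
  if x.IsScalar then 1 / 6
  else if x.trSq < 4 * x.det then -1 / (Nat.card (centralizer x) : ℚ)
  else if ∃ u : ℤ, 0 < u ∧ x.trSq - 4 * x.det = u ^ 2 then 1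
  else 0

theorem PMat.isScalar_conj {x : PMat} (g : Gam) (h : x.IsScalar) :
    (toPMat g * x * toPMat g⁻¹) = x := by
  obtain ⟨a, rfl⟩ := h
  have hc : toPMat g * ((Matrix.scalar (Fin 2) a : Matrix (Fin 2) (Fin 2) ℤ) : PMat)
      = ((Matrix.scalar (Fin 2) a : Matrix (Fin 2) (Fin 2) ℤ) : PMat) * toPMat g := by
    induction g using QuotientGroup.induction_on with
    | _ A =>
      change (((A : Matrix (Fin 2) (Fin 2) ℤ) * Matrix.scalar (Fin 2) a :
          Matrix (Fin 2) (Fin 2) ℤ) : PMat)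
        = ((Matrix.scalar (Fin 2) a * (A : Matrix (Fin 2) (Fin 2) ℤ) :
          Matrix (Fin 2) (Fin 2) ℤ) : PMat)
      rw [(Matrix.scalar_commute a (fun r => mul_comm a r) (A : Matrix (Fin 2) (Fin 2) ℤ)).eq]
  rw [hc, mul_assoc, ← map_mul, mul_inv_cancel, map_one, mul_one]

theorem conj_inv (g : Gam) (x : PMat) :
    toPMat g⁻¹ * (toPMat g * x * toPMat g⁻¹) * toPMat g⁻¹⁻¹ = x := by
  rw [inv_inv]
  calc toPMat g⁻¹ * (toPMat g * x * toPMat g⁻¹) * toPMat g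
      = (toPMat g⁻¹ * toPMat g) * x * (toPMat g⁻¹ * toPMat g) := by simp only [mul_assoc]
    _ = x := by rw [← map_mul, inv_mul_cancel, map_one, one_mul, mul_one]

theorem mem_centralizer_conj (g h : Gam) (x : PMat) (hh : h ∈ centralizer x) :
    g * h * g⁻¹ ∈ centralizer (toPMat g * x * toPMat g⁻¹) := by
  change toPMat (g * h * g⁻¹) * (toPMat g * x * toPMat g⁻¹)
    = (toPMat g * x * toPMat g⁻¹) * toPMat (g * h * g⁻¹)
  change toPMat h * x = x * toPMat h at hh
  have e : ∀ y : PMat, toPMat g⁻¹ * (toPMat g * y) = y := fun y => by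
    rw [← mul_assoc, ← map_mul, inv_mul_cancel, map_one, one_mul]
  simp only [map_mul, mul_assoc, e]
  rw [← mul_assoc (toPMat h), hh, mul_assoc]

theorem card_centralizer_conj (g : Gam) (x : PMat) :
    Nat.card (centralizer (toPMat g * x * toPMat g⁻¹)) = Nat.card (centralizer x) :=
  Nat.card_congr
    { toFun := fun h => ⟨g⁻¹ * h.1 * g, by
        have := mem_centralizer_conj g⁻¹ h.1 _ h.2
        rwa [conj_inv, inv_inv] at this⟩
      invFun := fun h => ⟨g * h.1 * g⁻¹, mem_centralizer_conj g h.1 x h.2⟩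
      left_inv := fun h => Subtype.ext (by simp [mul_assoc])
      right_inv := fun h => Subtype.ext (by simp [mul_assoc]) }

theorem weight_conj (g : Gam) (x : PMat) :
    weight (toPMat g * x * toPMat g⁻¹) = weight x := by
  have hs : (toPMat g * x * toPMat g⁻¹).IsScalar ↔ x.IsScalar := by
    constructor
    · intro h
      have := PMat.isScalar_conj g⁻¹ h
      rw [conj_inv] at this
      rwa [this]
    · intro h
      rwa [PMat.isScalar_conj g h]
  have hd : (toPMat g * x * toPMat g⁻¹).det = x.det := by
    rw [PMat.det_mul, PMat.det_mul, det_toPMat, det_toPMat, one_mul, mul_one]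
  by_cases h : x.IsScalar
  · rw [PMat.isScalar_conj g h]
  · unfold weight
    rw [if_neg h, if_neg (mt hs.1 h), hd, PMat.trSq_conj, card_centralizer_conj]

/-- The weight of a conjugacy class. -/
def ConjClass.weight {n : ℕ} (X : ConjClass n) : ℚ :=
  Quotient.lift (fun x : HMat n => KroneckerHurwitz.weight x.1) (by
    rintro x y ⟨g, hg⟩
    rw [hg, weight_conj]) X

/-- The square of the trace of the elements of a conjugacy class. -/
def ConjClass.trSq {n : ℕ} (X : ConjClass n) : ℤ :=
  Quotient.lift (fun x : HMat n => x.1.trSq) (by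
    rintro x y ⟨g, hg⟩
    rw [hg, PMat.trSq_conj]) X

/-- The integral binary quadratic form `a x² + b x y + c y²`. -/
@[ext]
structure BinForm where
  a : ℤ
  b : ℤ
  c : ℤ

/-- The value of a form at `(x, y)`. -/
def BinForm.eval (f : BinForm) (x y : ℤ) : ℤ := f.a * x ^ 2 + f.b * x * y + f.c * y ^ 2

/-- The discriminant of a form. -/
def BinForm.disc (f : BinForm) : ℤ := f.b ^ 2 - 4 * f.a * f.c

/-- Positive definiteness. -/
def BinForm.PosDef (f : BinForm) : Prop := ∀ x y : ℤ, (x, y) ≠ (0, 0) → 0 < f.eval x y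

/-- `f` and `f'` are equivalent if `f' (x, y) = f (p x + q y, r x + s y)` for a matrix
`(p, q; r, s)` of determinant `1`. The matrix matters only up to sign. -/
def BinForm.Equiv (f f' : BinForm) : Prop :=
  ∃ g : SL(2, ℤ), ∀ x y : ℤ, f'.eval x y = f.eval (g 0 0 * x + g 0 1 * y) (g 1 0 * x + g 1 1 * y)

/-- The positive definite forms of discriminant `-D`. -/
abbrev PosForm (D : ℤ) : Type := {f : BinForm // f.PosDef ∧ f.disc = -D}

/-- Equivalence of positive definite forms of discriminant `-D` under the modular group. -/
def formSetoid (D : ℤ) : Setoid (PosForm D) where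
  r f f' := f.1.Equiv f'.1
  iseqv :=
    { refl := fun f => ⟨1, by simp⟩
      symm := by
        rintro f f' ⟨g, hg⟩
        have hdet : g 0 0 * g 1 1 - g 0 1 * g 1 0 = 1 := by
          have := g.det_coe
          rwa [Matrix.det_fin_two] at this
        refine ⟨g⁻¹, fun x y => ?_⟩
        rw [hg]
        congr 1
        · simp [Matrix.SpecialLinearGroup.coe_inv, Matrix.adjugate_fin_two]
          linear_combination (-x) * hdet
        · simp [Matrix.SpecialLinearGroup.coe_inv, Matrix.adjugate_fin_two]
          linear_combination (-y) * hdet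
      trans := by
        rintro f f' f'' ⟨g, hg⟩ ⟨h, hh⟩
        refine ⟨g * h, fun x y => ?_⟩
        rw [hh, hg]
        congr 1
        · simp [Matrix.mul_apply, Fin.sum_univ_two]
          ring
        · simp [Matrix.mul_apply, Fin.sum_univ_two]
          ring }

/-- The classes of positive definite integral binary quadratic forms of discriminant `-D`. -/
abbrev FormClass (D : ℤ) : Type := Quotient (formSetoid D)

open Classical in
/-- The multiplicity of a class of forms: `1/2` if it contains a multiple of `x² + y²`, `1/3` if it
contains a multiple of `x² - x y + y²`, and `1` otherwise. -/
def FormClass.mult {D : ℤ} (C : FormClass D) : ℚ :=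
  if ∃ f : PosForm D, ⟦f⟧ = C ∧ ∃ k : ℤ, f.1 = ⟨k, 0, k⟩ then 1 / 2
  else if ∃ f : PosForm D, ⟦f⟧ = C ∧ ∃ k : ℤ, f.1 = ⟨k, -k, k⟩ then 1 / 3
  else 1

open Classical in
/-- The Kronecker-Hurwitz class number, extended to all integers: for `D > 0` it counts the classes
of positive definite forms of discriminant `-D` with multiplicity, `H 0 = -1/12`,
`H (-u²) = -u/2` for `u > 0`, and `H D = 0` for the other negative `D`. -/
def H (D : ℤ) : ℚ :=
  if 0 < D then ∑ᶠ C : FormClass D, C.mult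
  else if D = 0 then -1 / 12
  else if IsSquare (-D) then -(Int.sqrt (-D) : ℚ) / 2
  else 0

end KroneckerHurwitz

end

/-!
The theorem rests on the identity `∑ H (4n - t²) = ∑ max a d`, the sums being over the `t` with
`t² ≤ 4n` and over `n = a d`; the rest of it identifies the two sides with weighted numbers of matrix
classes.

By Gauss's reduction theory (`BinForm.exists_isReduced`, `BinForm.IsReduced.eq_of_comp`) each class
of forms has a unique reduced member. It is better to use all forms `(C, m, B)` with `|m| ≤ B, C`:
they meet each class twice if those on the boundary of the region are counted with the weight
`cornerWt` (`sum_reducedFormWt`). A form of discriminant `t² - 4n` of this kind, together with `t`,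
is the same as an integral solution of `A D + B C = n` with `t = A + D`, `m = A - D`, so that
`∑ 12 H (4n - t²)` over `t² < 4n` is the weighted number of the solutions with `|A - D| ≤ B, C`
(`sum_ellipticTraces`).

These are counted by Liouville's elementary method (`sum_reducedQuad`). The solutions with `A D = 0`
are counted by hand. The other ones, according to the signs of `A` and `D`, correspond to positive
solutions of `x y + z w = n`. The substitution `(x, y, z, w) ↦ (x - z, y, z, w + y)` maps the positive
solutions with `z < x` bijectively to those with `y < w` (`solSum_shift`). For the weight
`liouvilleWt` the resulting relation, symmetrized over the eight obvious symmetries of `x y + z w`,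
agrees pointwise with the weight to be summed except where `x = z`, that is, where `n = x (y + w)`,
and there a divisor sum is left (`dihedral_defect`, `solSum_reducedWt`, `solSum_diagonalWt`).
The values `H 0` and `H (-u²)` turn `∑ max a d` into `σ₁(n)` (`sum_H`).

A matrix modulo sign is determined by its trace `t` and the form `det (v, M v)` of discriminant
`t² - 4n`, up to a common sign, and conjugation of the matrix is substitution in the form. So
elliptic classes are classes of forms, and centralizers are stabilizers of forms
(`finsum_traceClasses_elliptic`). Split hyperbolic matrices are conjugate to `(a, b; 0, d)` with `b`
modulo `a - d`, and only the scalar matrices count among those with `t² = 4n`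
(`finsum_traceClasses_hyperbolic`, `finsum_traceClasses_parabolic`). Finally, Hermite normal forms
show that there are `σ₁(n)` left classes (`card_leftQuot`).
-/

noncomputable section

namespace KroneckerHurwitz

/-! ### Positive solutions of `x y + z w = n` and Liouville's substitution -/

/-- The weight of a point of the region `0 ≤ s`, `0 ≤ t`: six times the fraction of a small disc
around the point that lies in the region, when the two boundary curves meet at the angle `2π/3`. -/
def cornerWt (s t : ℤ) : ℤ :=
  if s < 0 ∨ t < 0 then 0 else if s = 0 ∧ t = 0 then 2 else if s = 0 ∨ t = 0 then 3 else 6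

theorem cornerWt_of_pos {s t : ℤ} (hs : 0 < s) (ht : 0 < t) : cornerWt s t = 6 := by
  unfold cornerWt; grind

theorem cornerWt_of_neg_left {s t : ℤ} (hs : s < 0) : cornerWt s t = 0 := by
  unfold cornerWt; grind

theorem cornerWt_of_neg_right {s t : ℤ} (ht : t < 0) : cornerWt s t = 0 := by
  unfold cornerWt; grind

theorem cornerWt_zero_left {s t : ℤ} (hs : s = 0) (ht : 0 < t) : cornerWt s t = 3 := by
  unfold cornerWt; grind

theorem cornerWt_zero_right {s t : ℤ} (hs : 0 < s) (ht : t = 0) : cornerWt s t = 3 := by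
  unfold cornerWt; grind

theorem cornerWt_zero {s t : ℤ} (hs : s = 0) (ht : t = 0) : cornerWt s t = 2 := by
  unfold cornerWt; grind

/-- The positive solutions of `x y + z w = n`. -/
def posSol (n : ℤ) : Finset (ℤ × ℤ × ℤ × ℤ) :=
  (Finset.Icc 1 n ×ˢ Finset.Icc 1 n ×ˢ Finset.Icc 1 n ×ˢ Finset.Icc 1 n).filter
    fun p => p.1 * p.2.1 + p.2.2.1 * p.2.2.2 = n

theorem mem_posSol {n x y z w : ℤ} :
    (x, y, z, w) ∈ posSol n ↔ 0 < x ∧ 0 < y ∧ 0 < z ∧ 0 < w ∧ x * y + z * w = n := by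
  simp only [posSol, Finset.mem_filter, Finset.mem_product, Finset.mem_Icc]
  constructor
  · rintro ⟨⟨h1, h2, h3, h4⟩, h⟩
    exact ⟨by omega, by omega, by omega, by omega, h⟩
  · rintro ⟨h1, h2, h3, h4, h⟩
    refine ⟨⟨⟨?_, ?_⟩, ⟨?_, ?_⟩, ⟨?_, ?_⟩, ⟨?_, ?_⟩⟩, h⟩ <;> nlinarith [mul_pos h1 h2, mul_pos h3 h4]

/-- The sum of `f` over the positive solutions of `x y + z w = n`. -/
def solSum (n : ℤ) (f : ℤ → ℤ → ℤ → ℤ → ℤ) : ℤ :=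
  ∑ p ∈ posSol n, f p.1 p.2.1 p.2.2.1 p.2.2.2

theorem solSum_swap_left (n : ℤ) (f : ℤ → ℤ → ℤ → ℤ → ℤ) :
    solSum n (fun x y z w => f y x z w) = solSum n f := by
  refine Finset.sum_nbij' (fun p => (p.2.1, p.1, p.2.2.1, p.2.2.2))
    (fun p => (p.2.1, p.1, p.2.2.1, p.2.2.2)) ?_ ?_ ?_ ?_ ?_ <;> rintro ⟨x, y, z, w⟩ h <;>
    simp only [mem_posSol] at h ⊢
  all_goals exact ⟨h.2.1, h.1, h.2.2.1, h.2.2.2.1, by linarith [h.2.2.2.2, mul_comm x y]⟩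

theorem solSum_swap_right (n : ℤ) (f : ℤ → ℤ → ℤ → ℤ → ℤ) :
    solSum n (fun x y z w => f x y w z) = solSum n f := by
  refine Finset.sum_nbij' (fun p => (p.1, p.2.1, p.2.2.2, p.2.2.1))
    (fun p => (p.1, p.2.1, p.2.2.2, p.2.2.1)) ?_ ?_ ?_ ?_ ?_ <;> rintro ⟨x, y, z, w⟩ h <;>
    simp only [mem_posSol] at h ⊢
  all_goals exact ⟨h.1, h.2.1, h.2.2.2.1, h.2.2.1, by linarith [h.2.2.2.2, mul_comm z w]⟩

theorem solSum_swap_pairs (n : ℤ) (f : ℤ → ℤ → ℤ → ℤ → ℤ) :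
    solSum n (fun x y z w => f z w x y) = solSum n f := by
  refine Finset.sum_nbij' (fun p => (p.2.2.1, p.2.2.2, p.1, p.2.1))
    (fun p => (p.2.2.1, p.2.2.2, p.1, p.2.1)) ?_ ?_ ?_ ?_ ?_ <;> rintro ⟨x, y, z, w⟩ h <;>
    simp only [mem_posSol] at h ⊢
  all_goals exact ⟨h.2.2.1, h.2.2.2.1, h.1, h.2.1, by linarith [h.2.2.2.2]⟩

theorem solSum_add (n : ℤ) (f g : ℤ → ℤ → ℤ → ℤ → ℤ) :
    solSum n (fun x y z w => f x y z w + g x y z w) = solSum n f + solSum n g :=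
  Finset.sum_add_distrib

theorem solSum_sub (n : ℤ) (f g : ℤ → ℤ → ℤ → ℤ → ℤ) :
    solSum n (fun x y z w => f x y z w - g x y z w) = solSum n f - solSum n g :=
  Finset.sum_sub_distrib _ _

/-- Liouville's substitution `(x, y, z, w) ↦ (x - z, y, z, w + y)` is a bijection from the solutions
with `z < x` to those with `y < w`. -/
theorem solSum_shift (n : ℤ) (h : ℤ → ℤ → ℤ → ℤ → ℤ) :
    solSum n (fun x y z w => if z < x then h x y z w else 0) =
      solSum n (fun x y z w => if y < w then h (x + z) y z (w - y) else 0) := by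
  unfold solSum
  rw [← Finset.sum_filter, ← Finset.sum_filter]
  refine Finset.sum_nbij' (fun p => (p.1 - p.2.2.1, p.2.1, p.2.2.1, p.2.2.2 + p.2.1))
    (fun p => (p.1 + p.2.2.1, p.2.1, p.2.2.1, p.2.2.2 - p.2.1)) ?_ ?_ ?_ ?_ ?_ <;>
    rintro ⟨x, y, z, w⟩ hp <;> simp only [Finset.mem_filter, mem_posSol] at hp ⊢
  · obtain ⟨⟨h1, h2, h3, h4, h5⟩, h6⟩ := hp
    exact ⟨⟨by omega, h2, h3, by omega, by linear_combination h5⟩, by omega⟩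
  · obtain ⟨⟨h1, h2, h3, h4, h5⟩, h6⟩ := hp
    exact ⟨⟨by omega, h2, h3, by omega, by linear_combination h5⟩, by omega⟩
  all_goals simp

/-- The sum of `f` over the dihedral group of the eight permutations of the variables that preserve
`x y + z w` by exchanging the two products or the factors of a product. -/
def dihedral (f : ℤ → ℤ → ℤ → ℤ → ℤ) (x y z w : ℤ) : ℤ :=
  f x y z w + f y x z w + f x y w z + f y x w z + f z w x y + f z w y x + f w z x y + f w z y x

theorem solSum_dihedral (n : ℤ) (f : ℤ → ℤ → ℤ → ℤ → ℤ) :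
    solSum n (dihedral f) = 8 * solSum n f := by
  have e1 := solSum_swap_left n f
  have e2 := solSum_swap_right n f
  have e3 : solSum n (fun x y z w => f y x w z) = solSum n f := by
    rw [solSum_swap_left n (fun x y z w => f x y w z), e2]
  have p0 := solSum_swap_pairs n f
  have p1 : solSum n (fun x y z w => f z w y x) = solSum n f := by
    rw [← e2]; exact solSum_swap_pairs n (fun x y z w => f x y w z)
  have p2 : solSum n (fun x y z w => f w z x y) = solSum n f := by
    rw [← e1]; exact solSum_swap_pairs n (fun x y z w => f y x z w)
  have p3 : solSum n (fun x y z w => f w z y x) = solSum n f := by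
    rw [← e3]; exact solSum_swap_pairs n (fun x y z w => f y x w z)
  unfold dihedral
  simp only [solSum_add, e1, e2, e3, p0, p1, p2, p3]
  ring

/-- The weight of a positive solution that records the integral solutions of `a d + b c = n` with
`|a - d| ≤ b, c` and `a d ≠ 0`: the first term stands for those with `a, d` of the same sign, the
second one for those with `a, d` of opposite signs. -/
def reducedWt (x y z w : ℤ) : ℤ :=
  2 * cornerWt (z - |x - y|) (w - |x - y|) + 2 * (if w < y then cornerWt (x + w - y) (w - z) else 0)

/-- A weight whose variation under Liouville's substitution agrees with `reducedWt` off the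
hyperplane `x = z`, after symmetrization over the dihedral group. -/
def liouvilleWt (x y z w : ℤ) : ℤ :=
  (if y < x then -24 else if x = y then -12 else 0) + (if z < w then 12 else if z = w then 6 else 0)
    + (if x < y + w then if x < y + z then 12 else if x = y + z then 6 else 0 else 0)

/-- What remains of `reducedWt` on the hyperplane `x = z`. -/
def diagonalWt (x y z w : ℤ) : ℤ :=
  if x = z then
    (if x < y + w then 24 else if x = y + w then -12 else -24) - (if x = y then 12 else 0)
      - (if y < x then if x < y + w then 24 else 0 else 0)
  else 0

/-- The difference between `reducedWt` and the sum of the variation of `liouvilleWt` under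
Liouville's substitution and of `diagonalWt`. It vanishes after symmetrization. -/
def defect (x y z w : ℤ) : ℤ :=
  reducedWt x y z w - ((if z < x then liouvilleWt x y z w else 0)
    - (if y < w then liouvilleWt (x + z) y z (w - y) else 0)) - diagonalWt x y z w

-- The hypotheses put the largest variable first. The order of `x`, `y`, `z`, `w`, `y + z`, `y + w`
-- then decides all the conditions in the weights.
set_option maxHeartbeats 4000000 in
theorem dihedral_defect_of_max {x y z w : ℤ} (hy : 0 < y) (hw : 0 < w) (h1 : y ≤ x) (h2 : z ≤ x)
    (h3 : w ≤ z) : dihedral defect x y z w = 0 := by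
  have ea : |x - y| = x - y := abs_of_nonneg (by omega)
  have eb : |y - x| = x - y := by rw [abs_sub_comm, ea]
  have ec : |z - w| = z - w := abs_of_nonneg (by omega)
  have ed : |w - z| = z - w := by rw [abs_sub_comm, ec]
  unfold dihedral defect reducedWt liouvilleWt diagonalWt
  simp only [ea, eb, ec, ed]
  clear ea eb ec ed
  rcases lt_trichotomy x (y + z) with c1 | c1 | c1 <;>
  rcases lt_trichotomy x (y + w) with c2 | c2 | c2 <;>
  (try (exfalso; omega)) <;>
  rcases lt_trichotomy y z with c3 | c3 | c3 <;>
  rcases lt_trichotomy y w with c4 | c4 | c4 <;> (try (exfalso; omega)) <;>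
  rcases h1.lt_or_eq with d1 | d1 <;> (try (exfalso; omega)) <;>
  rcases h2.lt_or_eq with d2 | d2 <;> (try (exfalso; omega)) <;>
  rcases h3.lt_or_eq with d3 | d3 <;> (try (exfalso; omega)) <;>
  rcases lt_trichotomy z (w + y) with c5 | c5 | c5 <;> (try (exfalso; omega))
  all_goals clear h1 h2 h3
  all_goals try subst d1
  all_goals try subst d2
  all_goals try subst d3
  all_goals
    simp (disch := omega) only [if_pos, if_neg, cornerWt_of_pos, cornerWt_of_neg_left,
      cornerWt_of_neg_right, cornerWt_zero_left, cornerWt_zero_right, cornerWt_zero]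
    norm_num

theorem dihedral_perm (f : ℤ → ℤ → ℤ → ℤ → ℤ) (x y z w : ℤ) :
    dihedral f y x z w = dihedral f x y z w ∧ dihedral f x y w z = dihedral f x y z w ∧
      dihedral f z w x y = dihedral f x y z w := by
  unfold dihedral
  refine ⟨?_, ?_, ?_⟩ <;> ring

theorem dihedral_defect {x y z w : ℤ} (hx : 0 < x) (hy : 0 < y) (hz : 0 < z) (hw : 0 < w) :
    dihedral defect x y z w = 0 := by
  have perm := dihedral_perm defect
  -- the largest of the four is moved to the first place
  wlog h1 : y ≤ x generalizing x y
  · rw [← (perm x y z w).1]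
    exact this hy hx (by omega)
  wlog h3 : w ≤ z generalizing z w
  · rw [← (perm x y z w).2.1]
    exact this hw hz (by omega)
  rcases le_total z x with h2 | h2
  · exact dihedral_defect_of_max hy hw h1 h2 h3
  · rw [← (perm x y z w).2.2]
    exact dihedral_defect_of_max hw hy h3 h2 h1

/-- The variation of `liouvilleWt` sums to zero, so that only the diagonal weight is left. -/
theorem solSum_reducedWt (n : ℤ) : solSum n reducedWt = solSum n diagonalWt := by
  have h0 : solSum n (dihedral defect) = 0 := by
    refine Finset.sum_eq_zero ?_
    rintro ⟨x, y, z, w⟩ hp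
    rw [mem_posSol] at hp
    exact dihedral_defect hp.1 hp.2.1 hp.2.2.1 hp.2.2.2.1
  have h1 := solSum_dihedral n defect
  have h2 : solSum n defect = solSum n reducedWt
      - (solSum n (fun x y z w => if z < x then liouvilleWt x y z w else 0)
        - solSum n (fun x y z w => if y < w then liouvilleWt (x + z) y z (w - y) else 0))
      - solSum n diagonalWt := by
    simp only [← solSum_sub]
    rfl
  rw [solSum_shift] at h2
  linarith

theorem sum_Icc_diagonalWt {x m : ℤ} (hx : 0 < x) (hm : 0 < m) :
    ∑ y ∈ Finset.Icc 1 (m - 1), diagonalWt x y x (m - y) =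
      if x < m then 24 * (m - x) - 12 else if x = m then -12 * (m - 1) else -24 * (m - 1) := by
  have key : ∀ c : ℤ, ∑ y ∈ Finset.Icc 1 (m - 1), c = c * (m - 1) := by
    intro c
    rw [Finset.sum_const, Int.card_Icc, nsmul_eq_mul]
    rw [Int.toNat_of_nonneg (by omega)]
    ring
  rcases lt_trichotomy x m with h | h | h
  · have e : ∀ y ∈ Finset.Icc 1 (m - 1), diagonalWt x y x (m - y) =
        24 - (if x = y then 12 else 0) - (if y < x then 24 else 0) := by
      intro y _
      unfold diagonalWt
      simp only [show y + (m - y) = m by ring, if_true, h]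
    have e2 : (Finset.Icc 1 (m - 1)).filter (· < x) = Finset.Icc 1 (x - 1) := by
      ext y
      simp only [Finset.mem_filter, Finset.mem_Icc]
      omega
    rw [Finset.sum_congr rfl e, Finset.sum_sub_distrib, Finset.sum_sub_distrib, key,
      Finset.sum_ite_eq, if_pos (Finset.mem_Icc.2 ⟨by omega, by omega⟩), ← Finset.sum_filter, e2,
      if_pos h, Finset.sum_const, Int.card_Icc, nsmul_eq_mul]
    rw [Int.toNat_of_nonneg (by omega)]
    ring
  · have e : ∀ y ∈ Finset.Icc 1 (m - 1), diagonalWt x y x (m - y) = -12 := by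
      intro y hy
      rw [Finset.mem_Icc] at hy
      unfold diagonalWt
      simp only [show y + (m - y) = m by ring, if_true, h, lt_irrefl, if_false,
        show m ≠ y by omega]
      split_ifs <;> simp
    rw [Finset.sum_congr rfl e, key, if_neg (by omega), if_pos h]
  · have e : ∀ y ∈ Finset.Icc 1 (m - 1), diagonalWt x y x (m - y) = -24 := by
      intro y hy
      rw [Finset.mem_Icc] at hy
      unfold diagonalWt
      simp only [show y + (m - y) = m by ring, if_true, show ¬ x < m by omega, if_false,
        show x ≠ y by omega, show x ≠ m by omega]
      split_ifs <;> simp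
    rw [Finset.sum_congr rfl e, key, if_neg (by omega), if_neg (by omega)]

/-- The factorizations `n = a d` into positive integers. -/
def factorPairs (n : ℤ) : Finset (ℤ × ℤ) :=
  (Finset.Icc 1 n ×ˢ Finset.Icc 1 n).filter fun p => p.1 * p.2 = n

theorem mem_factorPairs {n a d : ℤ} : (a, d) ∈ factorPairs n ↔ 0 < a ∧ 0 < d ∧ a * d = n := by
  simp only [factorPairs, Finset.mem_filter, Finset.mem_product, Finset.mem_Icc]
  constructor
  · rintro ⟨⟨h1, h2⟩, h⟩
    exact ⟨by omega, by omega, h⟩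
  · rintro ⟨h1, h2, h⟩
    refine ⟨⟨⟨?_, ?_⟩, ⟨?_, ?_⟩⟩, h⟩ <;> nlinarith [mul_pos h1 h2]

theorem sum_factorPairs_swap {M : Type*} [AddCommMonoid M] (n : ℤ) (f : ℤ → ℤ → M) :
    ∑ p ∈ factorPairs n, f p.2 p.1 = ∑ p ∈ factorPairs n, f p.1 p.2 := by
  refine Finset.sum_nbij' Prod.swap Prod.swap ?_ ?_ ?_ ?_ ?_ <;> rintro ⟨a, d⟩ h <;>
    simp only [mem_factorPairs, Prod.swap] at h ⊢
  all_goals exact ⟨h.2.1, h.1, by linarith [h.2.2, mul_comm a d]⟩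

theorem solSum_diagonalWt (n : ℤ) :
    solSum n diagonalWt = ∑ p ∈ factorPairs n, (if p.1 < p.2 then 24 * (p.2 - p.1) - 12
      else if p.1 = p.2 then -12 * (p.2 - 1) else -24 * (p.2 - 1)) := by
  have h1 : ∑ p ∈ factorPairs n, (if p.1 < p.2 then 24 * (p.2 - p.1) - 12
      else if p.1 = p.2 then -12 * (p.2 - 1) else -24 * (p.2 - 1)) =
      ∑ p ∈ factorPairs n, ∑ y ∈ Finset.Icc 1 (p.2 - 1), diagonalWt p.1 y p.1 (p.2 - y) := by
    refine Finset.sum_congr rfl ?_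
    rintro ⟨a, d⟩ h
    rw [mem_factorPairs] at h
    exact (sum_Icc_diagonalWt h.1 h.2.1).symm
  rw [h1, Finset.sum_sigma', solSum]
  symm
  refine Finset.sum_of_injOn (fun q => (q.1.1, q.2, q.1.1, q.1.2 - q.2)) ?_ ?_ ?_ ?_
  · rintro ⟨⟨a, d⟩, y⟩ _ ⟨⟨a', d'⟩, y'⟩ _ h
    simp only [Prod.mk.injEq] at h
    obtain ⟨rfl, rfl, -, h⟩ := h
    obtain rfl : d = d' := by omega
    rfl
  · rintro ⟨⟨a, d⟩, y⟩ h
    simp only [Finset.coe_sigma, Set.mem_sigma_iff, Finset.mem_coe, mem_factorPairs,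
      Finset.mem_Icc] at h
    rw [Finset.mem_coe]
    dsimp only
    rw [mem_posSol]
    exact ⟨h.1.1, by omega, h.1.1, by omega, by linear_combination h.1.2.2⟩
  · rintro ⟨x, y, z, w⟩ h hn
    rw [mem_posSol] at h
    unfold diagonalWt
    rw [if_neg]
    intro hxz
    dsimp only at hxz
    subst hxz
    refine hn ⟨⟨(x, y + w), y⟩, ?_, by simp⟩
    simp only [Finset.coe_sigma, Set.mem_sigma_iff, Finset.mem_coe, mem_factorPairs,
      Finset.mem_Icc]
    exact ⟨⟨h.1, by omega, by linear_combination h.2.2.2.2⟩, by omega, by omega⟩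
  · rintro ⟨⟨a, d⟩, y⟩ _
    rfl

/-! ### The weighted number of reduced quadruples -/

/-- The integral solutions of `A D + B C = n` with `|A - D| ≤ B` and `|A - D| ≤ C`, `B, C > 0`. -/
def reducedQuad (n : ℤ) : Finset (ℤ × ℤ × ℤ × ℤ) :=
  (Finset.Icc (-(2 * n)) (2 * n) ×ˢ Finset.Icc (-(2 * n)) (2 * n) ×ˢ Finset.Icc 1 (2 * n) ×ˢ
    Finset.Icc 1 (2 * n)).filter fun p => p.1 * p.2.1 + p.2.2.1 * p.2.2.2 = n ∧
      |p.1 - p.2.1| ≤ p.2.2.1 ∧ |p.1 - p.2.1| ≤ p.2.2.2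

theorem mem_reducedQuad {n a d b c : ℤ} : (a, d, b, c) ∈ reducedQuad n ↔
    0 < b ∧ 0 < c ∧ a * d + b * c = n ∧ |a - d| ≤ b ∧ |a - d| ≤ c := by
  simp only [reducedQuad, Finset.mem_filter, Finset.mem_product, Finset.mem_Icc]
  constructor
  · rintro ⟨⟨_, _, h1, h2⟩, h⟩
    exact ⟨by omega, by omega, h⟩
  · rintro ⟨h1, h2, h3, h4, h5⟩
    refine ⟨?_, h3, h4, h5⟩
    have h6 : (a - d) ^ 2 ≤ b * c := by
      rw [← sq_abs, sq]
      exact mul_le_mul h4 h5 (abs_nonneg _) h1.le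
    have h7 : b * c ≤ 2 * n := by nlinarith [sq_nonneg (a + d)]
    have hb : b ≤ b * c := by nlinarith
    have hc : c ≤ b * c := by nlinarith
    have h8 : a ^ 2 + d ^ 2 ≤ 2 * n := by nlinarith [sq_nonneg (a + d), sq_nonneg (a - d)]
    have ha := sq_nonneg a
    have hd := sq_nonneg d
    refine ⟨⟨?_, ?_⟩, ⟨?_, ?_⟩, ⟨by omega, by omega⟩, by omega, by omega⟩ <;> nlinarith

/-- The weight of a quadruple of `reducedQuad`, half of it being lost on an edge `|A - D| = B` or
`|A - D| = C` and two thirds of it at a corner. -/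
def quadWt (p : ℤ × ℤ × ℤ × ℤ) : ℤ :=
  cornerWt (p.2.2.1 - |p.1 - p.2.1|) (p.2.2.2 - |p.1 - p.2.1|)

theorem cornerWt_eq_zero {s t : ℤ} (h : ¬(0 ≤ s ∧ 0 ≤ t)) : cornerWt s t = 0 := by
  unfold cornerWt
  rw [if_pos (by omega)]

theorem sum_reducedQuad_pos_pos (n : ℤ) :
    ∑ p ∈ reducedQuad n with 0 < p.1 ∧ 0 < p.2.1, quadWt p =
      solSum n fun x y z w => cornerWt (z - |x - y|) (w - |x - y|) := by
  refine Finset.sum_of_injOn id Function.injective_id.injOn ?_ ?_ fun _ _ => rfl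
  · rintro ⟨a, d, b, c⟩ h
    simp only [Finset.coe_filter, Set.mem_ofPred_eq, mem_reducedQuad] at h
    rw [id, Finset.mem_coe, mem_posSol]
    exact ⟨h.2.1, h.2.2, h.1.1, h.1.2.1, h.1.2.2.1⟩
  · rintro ⟨a, d, b, c⟩ h hn
    rw [mem_posSol] at h
    refine cornerWt_eq_zero fun h' => hn ⟨_, ?_, rfl⟩
    simp only [Finset.coe_filter, Set.mem_ofPred_eq, mem_reducedQuad]
    dsimp only at h'
    exact ⟨⟨h.2.2.1, h.2.2.2.1, h.2.2.2.2, by omega, by omega⟩, h.1, h.2.1⟩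

theorem sum_reducedQuad_neg_neg (n : ℤ) :
    ∑ p ∈ reducedQuad n with p.1 < 0 ∧ p.2.1 < 0, quadWt p =
      ∑ p ∈ reducedQuad n with 0 < p.1 ∧ 0 < p.2.1, quadWt p := by
  have e : ∀ a d : ℤ, |-a - -d| = |a - d| := fun a d => by
    rw [← abs_neg]; congr 1; ring
  refine Finset.sum_nbij' (fun p => (-p.1, -p.2.1, p.2.2.1, p.2.2.2))
    (fun p => (-p.1, -p.2.1, p.2.2.1, p.2.2.2)) ?_ ?_ ?_ ?_ ?_ <;> rintro ⟨a, d, b, c⟩ h <;>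
    simp only [Finset.mem_filter, mem_reducedQuad, e, quadWt, neg_neg, neg_mul_neg] at h ⊢
  all_goals exact ⟨h.1, by omega, by omega⟩

theorem sum_reducedQuad_neg_pos (n : ℤ) :
    ∑ p ∈ reducedQuad n with p.1 < 0 ∧ 0 < p.2.1, quadWt p =
      ∑ p ∈ reducedQuad n with 0 < p.1 ∧ p.2.1 < 0, quadWt p := by
  refine Finset.sum_nbij' (fun p => (p.2.1, p.1, p.2.2.1, p.2.2.2))
    (fun p => (p.2.1, p.1, p.2.2.1, p.2.2.2)) ?_ ?_ ?_ ?_ ?_ <;> rintro ⟨a, d, b, c⟩ h <;>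
    simp only [Finset.mem_filter, mem_reducedQuad, quadWt] at h ⊢
  · rw [abs_sub_comm, mul_comm d a]; exact ⟨h.1, by omega, by omega⟩
  · rw [abs_sub_comm, mul_comm d a]; exact ⟨h.1, by omega, by omega⟩
  · rw [abs_sub_comm]

/-- With `a = z`, `d = w - y`, `b = x + z`, `c = y`, the equation `a d + b c = n` becomes
`x y + z w = n`. -/
theorem sum_reducedQuad_pos_neg (n : ℤ) :
    ∑ p ∈ reducedQuad n with 0 < p.1 ∧ p.2.1 < 0, quadWt p =
      solSum n fun x y z w => if w < y then cornerWt (x + w - y) (w - z) else 0 := by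
  refine Finset.sum_of_injOn (fun p => (p.2.2.1 - p.1, p.2.2.2, p.1, p.2.2.2 + p.2.1))
    ?_ ?_ ?_ ?_
  · rintro ⟨a, d, b, c⟩ _ ⟨a', d', b', c'⟩ _ h
    simp only [Prod.mk.injEq] at h ⊢
    omega
  · rintro ⟨a, d, b, c⟩ h
    simp only [Finset.coe_filter, Set.mem_ofPred_eq, mem_reducedQuad] at h
    rw [abs_of_pos (by omega)] at h
    rw [Finset.mem_coe]
    dsimp only
    rw [mem_posSol]
    exact ⟨by omega, by omega, by omega, by omega, by linear_combination h.1.2.2.1⟩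
  · rintro ⟨x, y, z, w⟩ h hn
    rw [mem_posSol] at h
    dsimp only
    split_ifs with hwy
    · refine cornerWt_eq_zero fun h' => hn ⟨(z, w - y, x + z, y), ?_, ?_⟩
      · simp only [Finset.coe_filter, Set.mem_ofPred_eq, mem_reducedQuad]
        rw [abs_of_pos (by omega)]
        exact ⟨⟨by omega, by omega, by linear_combination h.2.2.2.2, by omega, by omega⟩,
          by omega, by omega⟩
      · dsimp only
        rw [add_sub_cancel_right, add_sub_cancel]
    · rfl
  · rintro ⟨a, d, b, c⟩ h
    simp only [Finset.mem_filter, mem_reducedQuad] at h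
    simp only [quadWt]
    rw [if_pos (by omega), abs_of_pos (by omega)]
    congr 1 <;> ring

theorem sum_Icc_cornerWt {b c : ℤ} (hb : 0 < b) (hc : 0 < c) :
    ∑ k ∈ Finset.Icc (-(min b c)) (min b c), cornerWt (b - |k|) (c - |k|) =
      12 * min b c - if b = c then 2 else 0 := by
  set m := min b c with hm
  have hm0 : 0 < m := lt_min hb hc
  have e : ∀ k ∈ Finset.Icc (-m) m, cornerWt (b - |k|) (c - |k|) =
      6 - (if m = k then (if b = c then 4 else 3) else 0)
        - (if -m = k then (if b = c then 4 else 3) else 0) := by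
    intro k hk
    rw [Finset.mem_Icc] at hk
    rcases abs_cases k with ⟨h1, h2⟩ | ⟨h1, h2⟩ <;> rw [h1] <;> unfold cornerWt <;> grind
  rw [Finset.sum_congr rfl e, Finset.sum_sub_distrib, Finset.sum_sub_distrib, Finset.sum_ite_eq,
    Finset.sum_ite_eq, if_pos (Finset.mem_Icc.2 ⟨by omega, le_rfl⟩),
    if_pos (Finset.mem_Icc.2 ⟨le_rfl, by omega⟩), Finset.sum_const, Int.card_Icc, nsmul_eq_mul]
  rw [Int.toNat_of_nonneg (by omega)]
  split_ifs <;> ring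

theorem sum_reducedQuad_right_zero (n : ℤ) :
    ∑ p ∈ reducedQuad n with p.2.1 = 0, quadWt p =
      ∑ p ∈ factorPairs n, (12 * min p.1 p.2 - if p.1 = p.2 then 2 else 0) := by
  have h1 : ∀ p ∈ factorPairs n, (12 * min p.1 p.2 - if p.1 = p.2 then 2 else 0) =
      ∑ k ∈ Finset.Icc (-(min p.1 p.2)) (min p.1 p.2), cornerWt (p.1 - |k|) (p.2 - |k|) := by
    rintro ⟨b, c⟩ h
    rw [mem_factorPairs] at h
    exact (sum_Icc_cornerWt h.1 h.2.1).symm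
  rw [Finset.sum_congr rfl h1, Finset.sum_sigma']
  refine Finset.sum_nbij' (fun p => ⟨(p.2.2.1, p.2.2.2), p.1⟩)
    (fun q => (q.2, 0, q.1.1, q.1.2)) ?_ ?_ ?_ ?_ ?_
  · rintro ⟨a, d, b, c⟩ h
    simp only [Finset.mem_filter, mem_reducedQuad] at h
    obtain ⟨h, rfl⟩ := h
    simp only [Finset.mem_sigma, mem_factorPairs, Finset.mem_Icc, ← abs_le]
    rw [sub_zero] at h
    exact ⟨⟨h.1, h.2.1, by linear_combination h.2.2.1⟩, le_min h.2.2.2.1 h.2.2.2.2⟩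
  · rintro ⟨⟨b, c⟩, k⟩ h
    simp only [Finset.mem_sigma, mem_factorPairs, Finset.mem_Icc, ← abs_le] at h
    simp only [Finset.mem_filter, mem_reducedQuad, sub_zero]
    exact ⟨⟨h.1.1, h.1.2.1, by linear_combination h.1.2.2, le_min_iff.1 h.2⟩, trivial⟩
  · rintro ⟨a, d, b, c⟩ h
    simp only [Finset.mem_filter] at h
    simp [h.2]
  · rintro ⟨⟨b, c⟩, k⟩ _
    rfl
  · rintro ⟨a, d, b, c⟩ h
    simp only [Finset.mem_filter] at h
    simp [quadWt, h.2]

theorem sum_reducedQuad_left_zero (n : ℤ) :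
    ∑ p ∈ reducedQuad n with p.1 = 0 ∧ p.2.1 ≠ 0, quadWt p =
      ∑ p ∈ factorPairs n, (12 * min p.1 p.2 - (if p.1 = p.2 then 2 else 0) - 6) := by
  have h1 : ∑ p ∈ reducedQuad n with p.1 = 0, quadWt p = ∑ p ∈ reducedQuad n with p.2.1 = 0,
      quadWt p := by
    refine Finset.sum_nbij' (fun p => (p.2.1, p.1, p.2.2.1, p.2.2.2))
      (fun p => (p.2.1, p.1, p.2.2.1, p.2.2.2)) ?_ ?_ ?_ ?_ ?_ <;> rintro ⟨a, d, b, c⟩ h <;>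
      simp only [Finset.mem_filter, mem_reducedQuad, quadWt] at h ⊢
    · rw [abs_sub_comm, mul_comm d a]; exact h
    · rw [abs_sub_comm, mul_comm d a]; exact h
    · rw [abs_sub_comm]
  have h2 : ∑ p ∈ reducedQuad n with p.1 = 0 ∧ p.2.1 = 0, quadWt p =
      ∑ p ∈ factorPairs n, 6 := by
    refine Finset.sum_nbij' (fun p => (p.2.2.1, p.2.2.2)) (fun q => (0, 0, q.1, q.2)) ?_ ?_ ?_ ?_ ?_
    · rintro ⟨a, d, b, c⟩ h
      simp only [Finset.mem_filter, mem_reducedQuad] at h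
      obtain ⟨h, rfl, rfl⟩ := h
      rw [mem_factorPairs]
      exact ⟨h.1, h.2.1, by linear_combination h.2.2.1⟩
    · rintro ⟨b, c⟩ h
      rw [mem_factorPairs] at h
      simp only [Finset.mem_filter, mem_reducedQuad]
      simp [h.1, h.2.1, h.2.2, h.1.le, h.2.1.le]
    · rintro ⟨a, d, b, c⟩ h
      simp only [Finset.mem_filter] at h
      simp [h.2]
    · rintro ⟨b, c⟩ _
      rfl
    · rintro ⟨a, d, b, c⟩ h
      simp only [Finset.mem_filter, mem_reducedQuad] at h
      obtain ⟨h, rfl, rfl⟩ := h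
      simp [quadWt, cornerWt_of_pos, h.1, h.2.1]
  have h3 := Finset.sum_filter_add_sum_filter_not ((reducedQuad n).filter fun p => p.1 = 0)
    (fun p => p.2.1 = 0) quadWt
  rw [Finset.filter_filter, Finset.filter_filter, h1, h2, sum_reducedQuad_right_zero] at h3
  rw [Finset.sum_sub_distrib]
  linarith

/-- The weighted number of reduced quadruples. The signs of the first two entries are separated;
those with nonzero product are counted by `solSum_reducedWt`. -/
theorem sum_reducedQuad (n : ℤ) :
    ∑ p ∈ reducedQuad n, quadWt p =
      ∑ p ∈ factorPairs n, (12 * max p.1 p.2 + if p.1 = p.2 then 2 else 0) := by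
  have split : ∑ p ∈ reducedQuad n, quadWt p =
      ∑ p ∈ reducedQuad n with 0 < p.1 ∧ 0 < p.2.1, quadWt p
      + ∑ p ∈ reducedQuad n with p.1 < 0 ∧ p.2.1 < 0, quadWt p
      + ∑ p ∈ reducedQuad n with 0 < p.1 ∧ p.2.1 < 0, quadWt p
      + ∑ p ∈ reducedQuad n with p.1 < 0 ∧ 0 < p.2.1, quadWt p
      + ∑ p ∈ reducedQuad n with p.2.1 = 0, quadWt p
      + ∑ p ∈ reducedQuad n with p.1 = 0 ∧ p.2.1 ≠ 0, quadWt p := by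
    simp only [Finset.sum_filter, ← Finset.sum_add_distrib]
    refine Finset.sum_congr rfl ?_
    rintro ⟨a, d, b, c⟩ _
    generalize quadWt (a, d, b, c) = q
    dsimp only
    split_ifs <;> omega
  have hred : solSum n reducedWt = 2 * solSum n (fun x y z w =>
      cornerWt (z - |x - y|) (w - |x - y|)) + 2 * solSum n (fun x y z w =>
      if w < y then cornerWt (x + w - y) (w - z) else 0) := by
    simp only [solSum, Finset.mul_sum, ← Finset.sum_add_distrib]
    rfl
  rw [split, sum_reducedQuad_neg_neg, sum_reducedQuad_neg_pos, sum_reducedQuad_pos_pos,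
    sum_reducedQuad_pos_neg, sum_reducedQuad_right_zero, sum_reducedQuad_left_zero]
  have h := (hred.symm.trans (solSum_reducedWt n)).trans (solSum_diagonalWt n)
  have hs : ∑ p ∈ factorPairs n, (if p.1 < p.2 then 24 * (p.2 - p.1) - 12
      else if p.1 = p.2 then -12 * (p.2 - 1) else -24 * (p.2 - 1))
      + ∑ p ∈ factorPairs n, (12 * min p.1 p.2 - if p.1 = p.2 then 2 else 0)
      + ∑ p ∈ factorPairs n, (12 * min p.1 p.2 - (if p.1 = p.2 then 2 else 0) - 6)
      = ∑ p ∈ factorPairs n, (12 * max p.1 p.2 + if p.1 = p.2 then 2 else 0) := by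
    -- the summands agree after symmetrization in the two factors
    let g : ℤ → ℤ → ℤ := fun a d => (if a < d then 24 * (d - a) - 12
      else if a = d then -12 * (d - 1) else -24 * (d - 1))
      + (12 * min a d - if a = d then 2 else 0) + (12 * min a d - (if a = d then 2 else 0) - 6)
      - (12 * max a d + if a = d then 2 else 0)
    have h0 : ∑ p ∈ factorPairs n, g p.1 p.2 = 0 := by
      have h1 : ∑ p ∈ factorPairs n, (g p.1 p.2 + g p.2 p.1) = 0 := by
        refine Finset.sum_eq_zero ?_
        rintro ⟨a, d⟩ _
        simp only [g]
        grind
      rw [Finset.sum_add_distrib, sum_factorPairs_swap n g] at h1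
      omega
    simp only [g, Finset.sum_sub_distrib, Finset.sum_add_distrib] at h0
    simp only [Finset.sum_sub_distrib, Finset.sum_add_distrib]
    linarith
  linarith

/-! ### Composition and reduction of binary quadratic forms -/

/-- The form `(x, y) ↦ f (g (x, y))`. -/
def BinForm.comp (f : BinForm) (g : SL(2, ℤ)) : BinForm where
  a := f.eval (g 0 0) (g 1 0)
  b := 2 * f.a * g 0 0 * g 0 1 + f.b * (g 0 0 * g 1 1 + g 0 1 * g 1 0) + 2 * f.c * g 1 0 * g 1 1
  c := f.eval (g 0 1) (g 1 1)

theorem BinForm.eval_comp (f : BinForm) (g : SL(2, ℤ)) (x y : ℤ) :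
    (f.comp g).eval x y = f.eval (g 0 0 * x + g 0 1 * y) (g 1 0 * x + g 1 1 * y) := by
  simp only [BinForm.comp, BinForm.eval]
  ring

theorem BinForm.ext_eval {f f' : BinForm} (h : ∀ x y, f.eval x y = f'.eval x y) : f = f' := by
  have h1 := h 1 0
  have h2 := h 0 1
  have h3 := h 1 1
  simp only [BinForm.eval] at h1 h2 h3
  ext <;> linarith

theorem BinForm.equiv_iff {f f' : BinForm} : f.Equiv f' ↔ ∃ g, f' = f.comp g := by
  refine exists_congr fun g => ⟨fun h => BinForm.ext_eval fun x y => ?_, ?_⟩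
  · rw [h, BinForm.eval_comp]
  · rintro rfl x y
    exact f.eval_comp g x y

theorem det_eq_one (g : SL(2, ℤ)) : g 0 0 * g 1 1 - g 0 1 * g 1 0 = 1 := by
  have := g.det_coe
  rwa [Matrix.det_fin_two] at this

theorem BinForm.comp_one (f : BinForm) : f.comp 1 = f := by
  refine BinForm.ext_eval fun x y => ?_
  simp [BinForm.eval_comp]

theorem BinForm.comp_mul (f : BinForm) (g h : SL(2, ℤ)) : f.comp (g * h) = (f.comp g).comp h := by
  refine BinForm.ext_eval fun x y => ?_
  simp only [BinForm.eval_comp]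
  congr 1 <;> simp [Matrix.mul_apply, Fin.sum_univ_two] <;> ring

theorem BinForm.disc_comp (f : BinForm) (g : SL(2, ℤ)) : (f.comp g).disc = f.disc := by
  have h := det_eq_one g
  have : (f.comp g).disc = f.disc * (g 0 0 * g 1 1 - g 0 1 * g 1 0) ^ 2 := by
    simp only [BinForm.comp, BinForm.disc, BinForm.eval]
    ring
  rw [this, h, one_pow, mul_one]

theorem BinForm.PosDef.comp {f : BinForm} (hf : f.PosDef) (g : SL(2, ℤ)) : (f.comp g).PosDef := by
  intro x y hxy
  rw [BinForm.eval_comp]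
  refine hf _ _ fun h => hxy ?_
  have hd := det_eq_one g
  rw [Prod.mk.injEq] at h ⊢
  obtain ⟨h1, h2⟩ := h
  exact ⟨by linear_combination (-x) * hd + g 1 1 * h1 - g 0 1 * h2,
    by linear_combination (-y) * hd + g 0 0 * h2 - g 1 0 * h1⟩

theorem BinForm.posDef_iff {f : BinForm} : f.PosDef ↔ 0 < f.a ∧ f.disc < 0 := by
  constructor
  · intro h
    have ha : 0 < f.a := by simpa [BinForm.eval] using h 1 0 (by simp)
    have h1 := h (-f.b) (2 * f.a) (by simp [ha.ne'])
    refine ⟨ha, ?_⟩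
    have h2 : f.eval (-f.b) (2 * f.a) = f.a * (-f.disc) := by
      simp only [BinForm.eval, BinForm.disc]
      ring
    rw [h2] at h1
    have := (mul_pos_iff_of_pos_left ha).1 h1
    omega
  · rintro ⟨ha, hd⟩ x y hxy
    have h1 : 4 * f.a * f.eval x y = (2 * f.a * x + f.b * y) ^ 2 + -f.disc * y ^ 2 := by
      simp only [BinForm.eval, BinForm.disc]
      ring
    by_cases hy : y = 0
    · subst hy
      have hx : x ≠ 0 := fun h => hxy (by rw [h])
      have h3 : f.eval x 0 = f.a * x ^ 2 := by
        simp only [BinForm.eval]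
        ring
      rw [h3]
      positivity
    · have h2 : 0 < -f.disc * y ^ 2 := by
        have : 0 < -f.disc := by omega
        positivity
      have h3 : 0 < 4 * f.a * f.eval x y := by
        rw [h1]
        positivity
      exact (mul_pos_iff_of_pos_left (by omega)).1 h3

/-- Gauss's reducedness conditions `-a < b ≤ a ≤ c`, with `0 ≤ b` if `a = c`, and `a > 0`. -/
structure BinForm.IsReduced (f : BinForm) : Prop where
  a_pos : 0 < f.a
  neg_lt : -f.a < f.b
  le_a : f.b ≤ f.a
  le_c : f.a ≤ f.c
  nonneg : f.a = f.c → 0 ≤ f.b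

theorem BinForm.IsReduced.posDef {f : BinForm} (h : f.IsReduced) : f.PosDef := by
  obtain ⟨h1, h2, h3, h4, h5⟩ := h
  refine BinForm.posDef_iff.2 ⟨h1, ?_⟩
  unfold BinForm.disc
  nlinarith

/-- The translation `τ ↦ τ + k`. -/
def transl (k : ℤ) : SL(2, ℤ) := ⟨!![1, k; 0, 1], by simp [Matrix.det_fin_two]⟩

/-- The inversion `τ ↦ -1 / τ`. -/
def invol : SL(2, ℤ) := ⟨!![0, -1; 1, 0], by simp [Matrix.det_fin_two]⟩

theorem BinForm.comp_transl (f : BinForm) (k : ℤ) :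
    f.comp (transl k) = ⟨f.a, f.b + 2 * f.a * k, f.a * k ^ 2 + f.b * k + f.c⟩ := by
  ext
  all_goals
    simp [BinForm.comp, BinForm.eval, transl]
    try ring

theorem BinForm.comp_invol (f : BinForm) : f.comp invol = ⟨f.c, -f.b, f.a⟩ := by
  ext <;> simp [BinForm.comp, BinForm.eval, invol]

theorem BinForm.PosDef.c_pos {f : BinForm} (h : f.PosDef) : 0 < f.c := by
  simpa [BinForm.eval] using h 0 1 (by simp)

/-- Gauss's reduction, by induction on the first coefficient. -/
theorem BinForm.exists_isReduced (f : BinForm) (hf : f.PosDef) :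
    ∃ g, (f.comp g).IsReduced := by
  induction hN : f.a.toNat using Nat.strong_induction_on generalizing f with
  | _ N ih =>
    have ha := (BinForm.posDef_iff.1 hf).1
    obtain ⟨k, hk1, hk2⟩ : ∃ k : ℤ, -f.a < f.b + 2 * f.a * k ∧ f.b + 2 * f.a * k ≤ f.a := by
      refine ⟨-((f.b + f.a - 1) / (2 * f.a)), ?_, ?_⟩
      · have h1 := Int.mul_ediv_add_emod (f.b + f.a - 1) (2 * f.a)
        have h2 := Int.emod_nonneg (f.b + f.a - 1) (b := 2 * f.a) (by omega)
        nlinarith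
      · have h1 := Int.mul_ediv_add_emod (f.b + f.a - 1) (2 * f.a)
        have h2 := Int.emod_lt_of_pos (f.b + f.a - 1) (b := 2 * f.a) (by omega)
        nlinarith
    set f' := f.comp (transl k) with hf'
    have hp' : f'.PosDef := hf.comp _
    have hc := hp'.c_pos
    have ea : f'.a = f.a := by rw [hf', BinForm.comp_transl]
    have eb : f'.b = f.b + 2 * f.a * k := by rw [hf', BinForm.comp_transl]
    rw [← eb, ← ea] at hk1 hk2
    rcases lt_trichotomy f'.c f'.a with h | h | h
    · obtain ⟨g, hg⟩ := ih f'.c.toNat (by omega) (f'.comp invol) (hp'.comp _)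
        (by rw [BinForm.comp_invol])
      refine ⟨transl k * (invol * g), ?_⟩
      rwa [BinForm.comp_mul, BinForm.comp_mul]
    · by_cases hb : 0 ≤ f'.b
      · refine ⟨transl k, ?_⟩
        rw [← hf']
        exact ⟨by omega, hk1, hk2, h.ge, fun _ => hb⟩
      · refine ⟨transl k * invol, ?_⟩
        rw [BinForm.comp_mul, ← hf', BinForm.comp_invol]
        constructor <;> dsimp only <;> omega
    · refine ⟨transl k, ?_⟩
      rw [← hf']
      exact ⟨by omega, hk1, hk2, h.le, fun h' => by omega⟩

theorem one_le_sq_sub_abs_add_sq {p r : ℤ} (h : p ≠ 0 ∨ r ≠ 0) :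
    1 ≤ p ^ 2 - |p * r| + r ^ 2 := by
  have h1 : 0 < p ^ 2 + r ^ 2 := by
    rcases h with h | h <;> positivity
  rcases abs_cases (p * r) with ⟨h2, -⟩ | ⟨h2, -⟩ <;> rw [h2] <;>
    nlinarith [sq_nonneg (p - r), sq_nonneg (p + r)]

/-- The estimate behind the minimality of the first coefficient of a reduced form. -/
theorem BinForm.IsReduced.a_mul_le {f : BinForm} (h : f.IsReduced) (p r : ℤ) :
    f.a * (p ^ 2 - |p * r| + r ^ 2) ≤ f.eval p r := by
  obtain ⟨h1, h2, h3, h4, h5⟩ := h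
  have h6 : -(f.a * |p * r|) ≤ f.b * p * r := by
    have : |f.b * (p * r)| ≤ f.a * |p * r| := by
      rw [abs_mul]
      exact mul_le_mul_of_nonneg_right (abs_le.2 ⟨h2.le, h3⟩) (abs_nonneg _)
    have := (abs_le.1 this).1
    linarith [mul_assoc f.b p r]
  unfold BinForm.eval
  nlinarith [mul_le_mul_of_nonneg_right h4 (sq_nonneg r)]

theorem BinForm.IsReduced.a_le {f : BinForm} (h : f.IsReduced) (g : SL(2, ℤ)) :
    f.a ≤ (f.comp g).a := by
  have h0 : 1 ≤ (g 0 0) ^ 2 - |g 0 0 * g 1 0| + (g 1 0) ^ 2 := by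
    refine one_le_sq_sub_abs_add_sq ?_
    by_contra! h0
    have hd := det_eq_one g
    rw [h0.1, h0.2] at hd
    omega
  have := h.a_mul_le (g 0 0) (g 1 0)
  have := mul_le_mul_of_nonneg_left h0 h.a_pos.le
  simp only [BinForm.comp]
  linarith

theorem sq_sub_abs_add_sq_eq_one {p r : ℤ} (h : p ^ 2 - |p * r| + r ^ 2 = 1) :
    p ^ 2 ≤ 1 ∧ r ^ 2 ≤ 1 := by
  rw [abs_mul] at h
  rw [← sq_abs p, ← sq_abs r] at *
  constructor <;> by_contra hlt <;>
  nlinarith [abs_nonneg p, abs_nonneg r, sq_nonneg (2 * |p| - |r|), sq_nonneg (2 * |r| - |p|)]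

/-- Equivalent reduced forms are equal; the substitutions that fix a reduced form are the trivial
ones, those of order two in `PSL₂(ℤ)` for `a (x² + y²)`, and those of order three for
`a (x² + x y + y²)`. -/
theorem BinForm.IsReduced.eq_of_comp {f f' : BinForm} (h : f.IsReduced) (h' : f'.IsReduced)
    {g : SL(2, ℤ)} (hg : f.comp g = f') :
    f = f' ∧ (g 0 1 = 0 ∧ g 1 0 = 0 ∨
      (f.b = 0 ∧ f.a = f.c) ∧ g 0 0 = 0 ∧ g 1 1 = 0 ∨
      (f.b = f.a ∧ f.a = f.c) ∧ (g 0 0 = 0 ∧ g 1 1 = g 1 0 ∨ g 1 1 = 0 ∧ g 0 0 = g 0 1)) := by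
  have haa : f'.a = f.a := by
    refine le_antisymm ?_ (hg ▸ h.a_le g)
    have := h'.a_le g⁻¹
    rwa [← hg, ← BinForm.comp_mul, mul_inv_cancel, BinForm.comp_one, hg] at this
  have hdisc : f'.disc = f.disc := by rw [← hg, BinForm.disc_comp]
  have hd := det_eq_one g
  have ha : f.eval (g 0 0) (g 1 0) = f.a := by rw [← haa, ← hg]; rfl
  have hb : 2 * f.a * g 0 0 * g 0 1 + f.b * (g 0 0 * g 1 1 + g 0 1 * g 1 0)
    + 2 * f.c * g 1 0 * g 1 1 = f'.b := by rw [← hg]; rfl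
  have hN : (g 0 0) ^ 2 - |g 0 0 * g 1 0| + (g 1 0) ^ 2 = 1 := by
    refine le_antisymm ?_ (one_le_sq_sub_abs_add_sq ?_)
    · have := h.a_mul_le (g 0 0) (g 1 0)
      rw [ha] at this
      have h0 := h.a_pos
      nlinarith
    · by_contra! h0
      rw [h0.1, h0.2] at hd
      omega
  have hpr := sq_sub_abs_add_sq_eq_one hN
  obtain ⟨a, b, c⟩ := f
  obtain ⟨a', b', c'⟩ := f'
  obtain ⟨h1, h2, h3, h4, h5⟩ := h
  obtain ⟨h1', h2', h3', h4', h5'⟩ := h'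
  simp only [BinForm.eval, BinForm.disc, BinForm.mk.injEq] at *
  clear hN hg
  generalize g 0 0 = p at *
  generalize g 0 1 = q at *
  generalize g 1 0 = r at *
  generalize g 1 1 = s at *
  subst haa
  have hbc : b = b' → c = c' := by
    rintro rfl
    nlinarith
  obtain ⟨hp, hr⟩ := hpr
  have hp : p = 0 ∨ p = 1 ∨ p = -1 := by
    have h1 : p ≤ 1 := by nlinarith
    have h2 : -1 ≤ p := by nlinarith
    omega
  have hr : r = 0 ∨ r = 1 ∨ r = -1 := by
    have h1 : r ≤ 1 := by nlinarith
    have h2 : -1 ≤ r := by nlinarith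
    omega
  have small : ∀ k : ℤ, -a' < a' * k → a' * k < 2 * a' → k = 0 ∨ k = 1 := by
    intro k hk1 hk2
    have e1 : -1 < k := by nlinarith
    have e2 : k < 2 := by nlinarith
    omega
  by_cases hr0 : r = 0
  · subst hr0
    have hps : p * s = 1 := by linarith
    have e1 : 2 * (a' * (p * q)) = b' - b := by linear_combination hb - b * hps
    have e2 : p * q = 0 := by
      rcases small (p * q) (by linarith) (by linarith) with h | h
      · exact h
      · rw [h] at e1
        linarith
    have hq : q = 0 := by
      rcases mul_eq_zero.1 e2 with h | h
      · rw [h] at hps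
        omega
      · exact h
    have e3 : b = b' := by
      rw [e2] at e1
      linarith
    exact ⟨⟨rfl, e3, hbc e3⟩, Or.inl ⟨hq, rfl⟩⟩
  have hr2 : r ^ 2 = 1 := by
    rcases hr with rfl | rfl | rfl
    · exact absurd rfl hr0
    all_goals norm_num
  by_cases hp0 : p = 0
  · subst hp0
    have hqr : q * r = -1 := by linarith
    have hca : a' = c := by linear_combination -ha + c * hr2
    subst hca
    have e1 : 2 * (a' * (r * s)) = b' + b := by linear_combination hb - b * hqr
    have hb0 := h5 rfl
    rcases small (r * s) (by linarith) (by linarith) with h | h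
    · rw [h] at e1
      have e2 : b' = -b := by linarith
      have e3 : a' = c' := by
        subst e2
        nlinarith
      have e4 : b = 0 := by
        have := h5' e3
        omega
      have e5 : b = b' := by omega
      refine ⟨⟨rfl, e5, e3⟩, Or.inr (Or.inl ⟨⟨e4, rfl⟩, rfl, ?_⟩)⟩
      exact (mul_eq_zero.1 h).resolve_left hr0
    · rw [h] at e1
      have e2 : b = a' := by linarith
      have e3 : b = b' := by linarith
      exact ⟨⟨rfl, e3, hbc e3⟩, Or.inr (Or.inr ⟨⟨e2, rfl⟩, Or.inl ⟨rfl,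
        by linear_combination r * h - s * hr2⟩⟩)⟩
  · have hp2 : p ^ 2 = 1 := by
      rcases hp with rfl | rfl | rfl
      · exact absurd rfl hp0
      all_goals norm_num
    have hcb : c = -(b * (p * r)) := by linear_combination ha - a' * hp2 - c * hr2
    have hpr : p * r = 1 ∨ p * r = -1 := by
      rw [← sq_eq_one_iff, mul_pow, hp2, hr2, one_mul]
    rcases hpr with hpr | hpr
    · rw [hpr] at hcb
      omega
    · rw [hpr] at hcb
      have e1 : b = a' := by omega
      have e2 : c = a' := by omega
      subst e1 e2
      have e3 : r = -p := by linear_combination p * hpr - r * hp2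
      subst e3
      -- `p (q + s) = 1` makes the new middle coefficient an odd multiple of the first one
      have e4 : p * q + p * s = 1 := by linarith
      have e5 : 2 * (c * (p * q)) = b' + c := by
        linear_combination hb + c * e4
      rcases small (p * q) (by linarith) (by linarith) with h | h
      · rw [h] at e5
        linarith
      · rw [h] at e5
        have e6 : c = b' := by linarith
        have e7 : s = 0 := (mul_eq_zero.1 (show p * s = 0 by linarith)).resolve_left hp0
        exact ⟨⟨rfl, e6, hbc e6⟩, Or.inr (Or.inr ⟨⟨rfl, rfl⟩, Or.inr ⟨e7,
          by linear_combination (-p) * h + q * hp2⟩⟩)⟩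

/-! ### Class numbers as weighted numbers of quadruples -/

/-- The coefficients `(a, b, c)` of the reduced forms of discriminant `-D`. -/
def reducedForms (D : ℤ) : Finset (ℤ × ℤ × ℤ) :=
  (Finset.Icc 1 D ×ˢ Finset.Icc (-D) D ×ˢ Finset.Icc 1 D).filter fun p =>
    (-p.1 < p.2.1 ∧ p.2.1 ≤ p.1 ∧ p.1 ≤ p.2.2 ∧ (p.1 = p.2.2 → 0 ≤ p.2.1)) ∧
      4 * p.1 * p.2.2 - p.2.1 ^ 2 = D

/-- The coefficients `(a, b, c)` of the forms of discriminant `-D` with `|b| ≤ a` and `|b| ≤ c`,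
where `a, c > 0`. -/
def weaklyReducedForms (D : ℤ) : Finset (ℤ × ℤ × ℤ) :=
  (Finset.Icc 1 D ×ˢ Finset.Icc (-D) D ×ˢ Finset.Icc 1 D).filter fun p =>
    (|p.2.1| ≤ p.1 ∧ |p.2.1| ≤ p.2.2) ∧ 4 * p.1 * p.2.2 - p.2.1 ^ 2 = D

theorem mem_weaklyReducedForms {D a b c : ℤ} : (a, b, c) ∈ weaklyReducedForms D ↔
    0 < a ∧ 0 < c ∧ |b| ≤ a ∧ |b| ≤ c ∧ 4 * a * c - b ^ 2 = D := by
  simp only [weaklyReducedForms, Finset.mem_filter, Finset.mem_product, Finset.mem_Icc]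
  constructor
  · rintro ⟨⟨h1, h2, h3⟩, ⟨h4, h5⟩, h6⟩
    exact ⟨by omega, by omega, h4, h5, h6⟩
  · rintro ⟨h1, h2, h3, h4, h5⟩
    have h6 : b ^ 2 ≤ a * c := by
      rw [← sq_abs, sq]
      exact mul_le_mul h3 h4 (abs_nonneg _) h1.le
    have h7 : a ≤ a * c := by nlinarith
    have h8 : c ≤ a * c := by nlinarith
    have h9 := abs_le.1 (h3.trans (show a ≤ D by nlinarith))
    exact ⟨⟨⟨by omega, by nlinarith⟩, ⟨by omega, by omega⟩, by omega, by nlinarith⟩,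
      ⟨h3, h4⟩, h5⟩

theorem mem_reducedForms {D a b c : ℤ} : (a, b, c) ∈ reducedForms D ↔
    (⟨a, b, c⟩ : BinForm).IsReduced ∧ (⟨a, b, c⟩ : BinForm).disc = -D := by
  have key : (a, b, c) ∈ reducedForms D ↔ (a, b, c) ∈ weaklyReducedForms D ∧
      (-a < b ∧ b ≤ a ∧ a ≤ c ∧ (a = c → 0 ≤ b)) := by
    simp only [reducedForms, weaklyReducedForms, Finset.mem_filter, abs_le]
    constructor
    · rintro ⟨h1, ⟨h2, h3, h4, h5⟩, h6⟩
      exact ⟨⟨h1, ⟨⟨by omega, h3⟩, by omega, by omega⟩, h6⟩, h2, h3, h4, h5⟩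
    · rintro ⟨⟨h1, -, h6⟩, h⟩
      exact ⟨h1, h, h6⟩
  rw [key, mem_weaklyReducedForms]
  unfold BinForm.disc
  constructor
  · rintro ⟨⟨h1, h2, h3, h4, h5⟩, h6, h7, h8, h9⟩
    exact ⟨⟨h1, h6, h7, h8, h9⟩, by dsimp only; linarith⟩
  · rintro ⟨⟨h1, h6, h7, h8, h9⟩, h5⟩
    dsimp only at *
    exact ⟨⟨h1, by omega, abs_le.2 ⟨by omega, by omega⟩, abs_le.2 ⟨by omega, by omega⟩,
      by linarith⟩, h6, h7, h8, h9⟩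

/-- The class of a reduced form. -/
def classOfReduced (D : ℤ) (p : reducedForms D) : FormClass D :=
  ⟦⟨⟨p.1.1, p.1.2.1, p.1.2.2⟩, (mem_reducedForms.1 p.2).1.posDef, (mem_reducedForms.1 p.2).2⟩⟧

theorem classOfReduced_bijective (D : ℤ) : Function.Bijective (classOfReduced D) := by
  constructor
  · rintro ⟨⟨a, b, c⟩, h⟩ ⟨⟨a', b', c'⟩, h'⟩ heq
    obtain ⟨g, hg⟩ := BinForm.equiv_iff.1 (Quotient.exact heq)
    have := ((mem_reducedForms.1 h).1.eq_of_comp (mem_reducedForms.1 h').1 hg.symm).1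
    simp only [BinForm.mk.injEq] at this
    obtain ⟨rfl, rfl, rfl⟩ := this
    rfl
  · intro C
    induction C using Quotient.inductionOn with
    | _ f =>
      obtain ⟨f, hf, hd⟩ := f
      obtain ⟨g, hg⟩ := f.exists_isReduced hf
      refine ⟨⟨((f.comp g).a, (f.comp g).b, (f.comp g).c),
        mem_reducedForms.2 ⟨hg, (f.disc_comp g).trans hd⟩⟩, ?_⟩
      exact ((formSetoid D).iseqv.symm (BinForm.equiv_iff.2 ⟨g, rfl⟩ :
        BinForm.Equiv f (f.comp g)) : _) |> Quotient.sound

theorem finite_formClass (D : ℤ) : Finite (FormClass D) :=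
  Finite.of_surjective _ (classOfReduced_bijective D).2

theorem mult_classOfReduced {D : ℤ} (p : reducedForms D) :
    (classOfReduced D p).mult =
      if p.1.2.1 = 0 ∧ p.1.1 = p.1.2.2 then 1 / 2
      else if p.1.2.1 = p.1.1 ∧ p.1.1 = p.1.2.2 then 1 / 3 else 1 := by
  obtain ⟨⟨a, b, c⟩, hp⟩ := p
  have hr := (mem_reducedForms.1 hp).1
  have h1 : (∃ f : PosForm D, ⟦f⟧ = classOfReduced D ⟨(a, b, c), hp⟩ ∧
      ∃ k : ℤ, f.1 = ⟨k, 0, k⟩) ↔ b = 0 ∧ a = c := by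
    constructor
    · rintro ⟨⟨f, hf⟩, he, k, rfl⟩
      have hk := (BinForm.posDef_iff.1 hf.1).1
      obtain ⟨g, hg⟩ := BinForm.equiv_iff.1 (Quotient.exact he)
      have hred : (⟨k, 0, k⟩ : BinForm).IsReduced := by
        constructor <;> dsimp only at * <;> omega
      have := (hred.eq_of_comp hr hg.symm).1
      simp only [BinForm.mk.injEq] at this
      omega
    · rintro ⟨rfl, rfl⟩
      exact ⟨_, rfl, a, rfl⟩
  have h2 : (∃ f : PosForm D, ⟦f⟧ = classOfReduced D ⟨(a, b, c), hp⟩ ∧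
      ∃ k : ℤ, f.1 = ⟨k, -k, k⟩) ↔ b = a ∧ a = c := by
    constructor
    · rintro ⟨⟨f, hf⟩, he, k, rfl⟩
      have hk := (BinForm.posDef_iff.1 hf.1).1
      obtain ⟨g, hg⟩ := BinForm.equiv_iff.1 (Quotient.exact he)
      have hred : (⟨k, k, k⟩ : BinForm).IsReduced := by
        constructor <;> dsimp only at * <;> omega
      have e : (⟨k, -k, k⟩ : BinForm) = (⟨k, k, k⟩ : BinForm).comp (transl (-1)) := by
        rw [BinForm.comp_transl]
        ext <;> dsimp only <;> ring
      replace hg : (⟨a, b, c⟩ : BinForm) = (⟨k, -k, k⟩ : BinForm).comp g := hg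
      rw [e, ← BinForm.comp_mul] at hg
      have := (hred.eq_of_comp hr hg.symm).1
      simp only [BinForm.mk.injEq] at this
      omega
    · rintro ⟨rfl, rfl⟩
      refine ⟨⟨⟨b, -b, b⟩, ?_⟩, ?_, b, rfl⟩
      · have e : (⟨b, -b, b⟩ : BinForm) = (⟨b, b, b⟩ : BinForm).comp (transl (-1)) := by
          rw [BinForm.comp_transl]
          ext <;> dsimp only <;> ring
        rw [e, BinForm.disc_comp]
        exact ⟨hr.posDef.comp _, (mem_reducedForms.1 hp).2⟩
      · refine Quotient.sound (BinForm.equiv_iff.2 ⟨transl 1, ?_⟩)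
        rw [BinForm.comp_transl]
        ext <;> dsimp only <;> ring
  unfold FormClass.mult
  simp only [h1, h2]

/-- Twelve times the multiplicity of the class of a form, if the form is reduced, and `0`
otherwise. -/
def reducedFormWt (a b c : ℤ) : ℤ :=
  if -a < b ∧ b ≤ a ∧ a ≤ c ∧ (a = c → 0 ≤ b) then
    if b = 0 ∧ a = c then 6 else if b = a ∧ a = c then 4 else 12
  else 0

theorem H_eq_sum_reducedFormWt {D : ℤ} (hD : 0 < D) :
    12 * H D = ((∑ p ∈ weaklyReducedForms D, reducedFormWt p.1 p.2.1 p.2.2 : ℤ) : ℚ) := by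
  have h1 : H D = ∑ p ∈ reducedForms D, (if p.2.1 = 0 ∧ p.1 = p.2.2 then (1 / 2 : ℚ)
      else if p.2.1 = p.1 ∧ p.1 = p.2.2 then 1 / 3 else 1) := by
    unfold H
    rw [if_pos hD, ← Finset.sum_coe_sort, ← finsum_eq_sum_of_fintype]
    exact (finsum_eq_of_bijective _ (classOfReduced_bijective D)
      fun p => (mult_classOfReduced p).symm).symm
  have h2 : reducedForms D = (weaklyReducedForms D).filter fun p =>
      -p.1 < p.2.1 ∧ p.2.1 ≤ p.1 ∧ p.1 ≤ p.2.2 ∧ (p.1 = p.2.2 → 0 ≤ p.2.1) := by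
    ext ⟨a, b, c⟩
    rw [Finset.mem_filter]
    simp only [reducedForms, weaklyReducedForms, Finset.mem_filter, abs_le]
    constructor
    · rintro ⟨h1, ⟨h2, h3, h4, h5⟩, h6⟩
      exact ⟨⟨h1, ⟨⟨by omega, h3⟩, by omega, by omega⟩, h6⟩, h2, h3, h4, h5⟩
    · rintro ⟨⟨h1, -, h6⟩, h⟩
      exact ⟨h1, h, h6⟩
  rw [h1, h2, Finset.mul_sum, Finset.sum_filter, Int.cast_sum]
  refine Finset.sum_congr rfl ?_
  rintro ⟨a, b, c⟩ _
  unfold reducedFormWt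
  dsimp only
  split_ifs <;> norm_num

/-- The weakly reduced forms meet each class twice: their roots fill the fundamental domain of the
modular group together with its image under `τ ↦ -1 / τ`, a region whose two corners in the
upper half plane have the angle `2π/3`. -/
theorem sum_reducedFormWt (D : ℤ) :
    ∑ p ∈ weaklyReducedForms D, reducedFormWt p.1 p.2.1 p.2.2 =
      ∑ p ∈ weaklyReducedForms D, cornerWt (p.1 - |p.2.1|) (p.2.2 - |p.2.1|) := by
  let G : ℤ → ℤ → ℤ → ℤ := fun a b c => reducedFormWt a b c - cornerWt (a - |b|) (c - |b|)
  have flip (F : ℤ → ℤ → ℤ → ℤ) : ∑ p ∈ weaklyReducedForms D, F p.1 (-p.2.1) p.2.2 =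
      ∑ p ∈ weaklyReducedForms D, F p.1 p.2.1 p.2.2 := by
    refine Finset.sum_nbij' (fun p => (p.1, -p.2.1, p.2.2)) (fun p => (p.1, -p.2.1, p.2.2))
      ?_ ?_ ?_ ?_ ?_ <;> rintro ⟨a, b, c⟩ h <;>
      simp only [mem_weaklyReducedForms, abs_neg, neg_sq, neg_neg] at h ⊢ <;> exact h
  have swap (F : ℤ → ℤ → ℤ → ℤ) : ∑ p ∈ weaklyReducedForms D, F p.2.2 p.2.1 p.1 =
      ∑ p ∈ weaklyReducedForms D, F p.1 p.2.1 p.2.2 := by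
    refine Finset.sum_nbij' (fun p => (p.2.2, p.2.1, p.1)) (fun p => (p.2.2, p.2.1, p.1))
      ?_ ?_ ?_ ?_ ?_ <;> rintro ⟨a, b, c⟩ h <;> simp only [mem_weaklyReducedForms] at h ⊢ <;>
      exact ⟨h.2.1, h.1, h.2.2.2.1, h.2.2.1, by linarith [h.2.2.2.2, mul_right_comm 4 a c]⟩
  have h0 : ∑ p ∈ weaklyReducedForms D, (G p.1 p.2.1 p.2.2 + G p.1 (-p.2.1) p.2.2
      + (G p.2.2 p.2.1 p.1 + G p.2.2 (-p.2.1) p.1)) = 0 := by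
    refine Finset.sum_eq_zero ?_
    rintro ⟨a, b, c⟩ h
    rw [mem_weaklyReducedForms] at h
    obtain ⟨h1, h2, h3, h4, -⟩ := h
    simp only [G, abs_neg]
    -- the four forms `(a, ±b, c)`, `(c, ±b, a)` are compared together
    rcases abs_cases b with ⟨hb, hb'⟩ | ⟨hb, hb'⟩ <;> rw [hb] at h3 h4 ⊢ <;>
    unfold reducedFormWt cornerWt <;>
    rcases lt_trichotomy a c with h5 | h5 | h5 <;>
    rcases h3.lt_or_eq with h6 | h6 <;> rcases h4.lt_or_eq with h7 | h7 <;>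
    (try (exfalso; omega)) <;>
    rcases eq_or_ne b 0 with h8 | h8 <;> (try (exfalso; omega)) <;>
    simp (disch := omega) only [if_pos, if_neg] <;> norm_num
  rw [Finset.sum_add_distrib, Finset.sum_add_distrib, Finset.sum_add_distrib, flip G,
    swap G, swap (fun a b c => G a (-b) c), flip G] at h0
  have h1 : ∑ p ∈ weaklyReducedForms D, G p.1 p.2.1 p.2.2 = 0 := by omega
  simp only [G, Finset.sum_sub_distrib] at h1
  omega

theorem two_dvd_sub_of_disc {t n a b c : ℤ} (h : b ^ 2 - 4 * a * c = t ^ 2 - 4 * n) :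
    (2 : ℤ) ∣ t - b := by
  have h6 : (t - b) * (t + b) = 4 * (n - a * c) := by linear_combination -h
  have h7 : Even ((t - b) * (t + b)) := ⟨2 * (n - a * c), by rw [h6]; ring⟩
  rw [Int.even_mul] at h7
  rcases h7 with ⟨k, hk⟩ | ⟨k, hk⟩
  · exact ⟨k, by omega⟩
  · exact ⟨k - b, by omega⟩

/-- The traces of the elliptic matrices of determinant `n`. -/
def ellipticTraces (n : ℤ) : Finset ℤ := (Finset.Icc (-(2 * n)) (2 * n)).filter (· ^ 2 < 4 * n)

theorem mem_ellipticTraces {n t : ℤ} : t ∈ ellipticTraces n ↔ t ^ 2 < 4 * n := by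
  simp only [ellipticTraces, Finset.mem_filter, Finset.mem_Icc, and_iff_right_iff_imp]
  intro h
  constructor <;> nlinarith

/-- The form `(C, A - D, B)` has discriminant `(A + D)² - 4 n` if `A D + B C = n`, so that the weakly
reduced forms of all discriminants `t² - 4 n < 0` together are the reduced quadruples. -/
theorem sum_ellipticTraces (n : ℤ) :
    ∑ t ∈ ellipticTraces n, 12 * H (4 * n - t ^ 2) =
      ((∑ p ∈ factorPairs n, (12 * max p.1 p.2 + if p.1 = p.2 then 2 else 0) : ℤ) : ℚ) := by
  have h1 : ∀ t ∈ ellipticTraces n, 12 * H (4 * n - t ^ 2) =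
      ((∑ p ∈ weaklyReducedForms (4 * n - t ^ 2),
        cornerWt (p.1 - |p.2.1|) (p.2.2 - |p.2.1|) : ℤ) : ℚ) := by
    intro t ht
    rw [mem_ellipticTraces] at ht
    rw [H_eq_sum_reducedFormWt (by omega), sum_reducedFormWt]
  rw [Finset.sum_congr rfl h1, ← Int.cast_sum, Int.cast_inj, ← sum_reducedQuad,
    Finset.sum_sigma']
  symm
  refine Finset.sum_bij' (fun p _ => ⟨p.1 + p.2.1, (p.2.2.2, p.1 - p.2.1, p.2.2.1)⟩)
    (fun q _ => ((q.1 + q.2.2.1) / 2, (q.1 - q.2.2.1) / 2, q.2.2.2, q.2.1)) ?_ ?_ ?_ ?_ ?_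
  · rintro ⟨a, d, b, c⟩ h
    rw [mem_reducedQuad] at h
    obtain ⟨h1, h2, h3, h4, h5⟩ := h
    rw [Finset.mem_sigma, mem_ellipticTraces, mem_weaklyReducedForms]
    refine ⟨?_, h2, h1, h5, h4, by linear_combination 4 * h3⟩
    have h6 : (a - d) ^ 2 ≤ b * c := by
      rw [← sq_abs, sq]
      exact mul_le_mul h4 h5 (abs_nonneg _) h1.le
    nlinarith [mul_pos h1 h2]
  · rintro ⟨t, a, b, c⟩ h
    rw [Finset.mem_sigma, mem_ellipticTraces, mem_weaklyReducedForms] at h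
    obtain ⟨-, h1, h2, h3, h4, h5⟩ := h
    dsimp only at h5
    obtain ⟨k, hk⟩ := two_dvd_sub_of_disc (show b ^ 2 - 4 * a * c = t ^ 2 - 4 * n by linarith)
    obtain rfl : t = b + 2 * k := by omega
    dsimp only
    rw [show (b + 2 * k + b) / 2 = b + k by omega, show (b + 2 * k - b) / 2 = k by omega,
      mem_reducedQuad, show b + k - k = b by ring]
    exact ⟨h2, h1, by linarith, h4, h3⟩
  · rintro ⟨a, d, b, c⟩ _
    dsimp only
    rw [show (a + d + (a - d)) / 2 = a by omega, show (a + d - (a - d)) / 2 = d by omega]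
  · rintro ⟨t, a, b, c⟩ h
    rw [Finset.mem_sigma, mem_ellipticTraces, mem_weaklyReducedForms] at h
    obtain ⟨-, h1, h2, h3, h4, h5⟩ := h
    dsimp only at h5
    obtain ⟨k, hk⟩ := two_dvd_sub_of_disc (show b ^ 2 - 4 * a * c = t ^ 2 - 4 * n by linarith)
    dsimp only
    rw [show (t + b) / 2 + (t - b) / 2 = t by omega, show (t + b) / 2 - (t - b) / 2 = b by omega]
  · rintro ⟨a, d, b, c⟩ _
    unfold quadWt cornerWt
    dsimp only
    split_ifs <;> omega

/-! ### Sums of class numbers -/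

theorem H_zero : H 0 = -1 / 12 := by
  simp [H]

theorem H_neg_sq {u : ℤ} (hu : 0 < u) : H (-u ^ 2) = -(u : ℚ) / 2 := by
  have h : 0 < u ^ 2 := by positivity
  unfold H
  rw [if_neg (by omega), if_neg (by omega), neg_neg, if_pos ⟨u, sq u⟩, sq, Int.sqrt_eq,
    Int.natCast_natAbs, abs_of_pos hu]

theorem exists_sq_of_H_ne_zero {D : ℤ} (hD : D < 0) (h : H D ≠ 0) : ∃ u : ℤ, 0 < u ∧ D = -u ^ 2 := by
  unfold H at h
  rw [if_neg (by omega), if_neg (by omega)] at h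
  split_ifs at h with hs
  · obtain ⟨u, hu⟩ := hs
    refine ⟨|u|, abs_pos.2 ?_, ?_⟩
    · rintro rfl
      omega
    · rw [sq_abs, sq]
      omega
  · exact absurd rfl h

/-- A nonnegative integer `t` for which `t² - 4n` is a square is the sum of two complementary
divisors of `n`. -/
theorem exists_factorPair {n t u : ℤ} (hn : 0 < n) (ht : 0 ≤ t) (hu : 0 ≤ u)
    (h : t ^ 2 - 4 * n = u ^ 2) : ∃ a d, (a, d) ∈ factorPairs n ∧ a + d = t ∧ a - d = u := by
  obtain ⟨d, hd⟩ := two_dvd_sub_of_disc (t := t) (n := n) (a := 0) (b := u) (c := 0)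
    (by linarith)
  obtain rfl : t = u + 2 * d := by omega
  have h1 : (u + d) * d = n := by linarith
  have hd0 : 0 < d := by
    by_contra! hneg
    have : (u + d) * d ≤ 0 := mul_nonpos_of_nonneg_of_nonpos (by omega) hneg
    omega
  exact ⟨u + d, d, mem_factorPairs.2 ⟨by omega, hd0, h1⟩, by ring, by ring⟩

theorem add_le_of_mem_factorPairs {n a d : ℤ} (h : (a, d) ∈ factorPairs n) : a + d ≤ n + 1 := by
  rw [mem_factorPairs] at h
  nlinarith [mul_nonneg (show 0 ≤ a - 1 by omega) (show 0 ≤ d - 1 by omega)]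

theorem abs_le_of_H_ne_zero {n t : ℤ} (hn : 0 < n) (h : H (4 * n - t ^ 2) ≠ 0) :
    |t| ≤ n + 1 := by
  rcases le_or_gt (t ^ 2) (4 * n) with h1 | h1
  · exact abs_le_of_sq_le_sq (by nlinarith [sq_nonneg (n - 1)]) (by omega)
  · obtain ⟨u, hu, he⟩ := exists_sq_of_H_ne_zero (by omega) h
    obtain ⟨a, d, had, hs, -⟩ := exists_factorPair hn (abs_nonneg t) hu.le
      (show |t| ^ 2 - 4 * n = u ^ 2 by rw [sq_abs]; omega)
    exact hs ▸ add_le_of_mem_factorPairs had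

theorem H_of_mem_factorPairs {n a d : ℤ} (h : (a, d) ∈ factorPairs n) (hda : d ≤ a) :
    H (4 * n - (a + d) ^ 2) = if a = d then -1 / 12 else -((a - d : ℤ) : ℚ) / 2 := by
  rw [mem_factorPairs] at h
  have e : 4 * n - (a + d) ^ 2 = -(a - d) ^ 2 := by rw [← h.2.2]; ring
  rw [e]
  split_ifs with had
  · rw [had, sub_self, zero_pow two_ne_zero, neg_zero, H_zero]
  · exact H_neg_sq (by omega)

theorem add_injOn_factorPairs (n : ℤ) :
    Set.InjOn (fun p : ℤ × ℤ => p.1 + p.2) ↑((factorPairs n).filter fun p => p.2 ≤ p.1) := by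
  rintro ⟨a, d⟩ h ⟨a', d'⟩ h' he
  simp only [Finset.coe_filter, Set.mem_ofPred_eq, mem_factorPairs] at h h'
  dsimp only at he
  obtain ⟨⟨h1, h2, h3⟩, h4⟩ := h
  obtain ⟨⟨h1', h2', h3'⟩, h4'⟩ := h'
  have h5 : (a - d) ^ 2 = (a' - d') ^ 2 := by
    have : (a + d) ^ 2 = (a' + d') ^ 2 := by rw [he]
    linarith
  rw [sq_eq_sq₀ (by omega) (by omega)] at h5
  rw [Prod.mk.injEq]
  omega

/-- The contribution of the hyperbolic and parabolic traces `t > 0`: they are the sums `a + d` of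
complementary divisors `a ≥ d` of `n`. -/
theorem sum_H_pos (n : ℤ) (hn : 0 < n) :
    ∑ t ∈ Finset.Icc 1 (n + 1) with 4 * n ≤ t ^ 2, H (4 * n - t ^ 2) =
      ∑ p ∈ factorPairs n with p.2 ≤ p.1,
        if p.1 = p.2 then -1 / 12 else -((p.1 - p.2 : ℤ) : ℚ) / 2 := by
  symm
  refine Finset.sum_of_injOn (fun p => p.1 + p.2) (add_injOn_factorPairs n) ?_ ?_ ?_
  · rintro ⟨a, d⟩ h
    simp only [Finset.coe_filter, Set.mem_ofPred_eq, Finset.mem_Icc] at h ⊢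
    have h1 := add_le_of_mem_factorPairs h.1
    rw [mem_factorPairs] at h
    exact ⟨⟨by omega, h1⟩, by nlinarith [sq_nonneg (a - d)]⟩
  · intro t ht hn'
    rw [Finset.mem_filter, Finset.mem_Icc] at ht
    by_contra hH
    refine hn' ?_
    obtain ⟨u, hu, he⟩ : ∃ u : ℤ, 0 ≤ u ∧ 4 * n - t ^ 2 = -u ^ 2 := by
      rcases ht.2.eq_or_lt with h | h
      · exact ⟨0, le_rfl, by omega⟩
      · obtain ⟨u, hu, he⟩ := exists_sq_of_H_ne_zero (by omega) hH
        exact ⟨u, hu.le, he⟩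
    obtain ⟨a, d, had, hs, hu'⟩ := exists_factorPair hn (by omega) hu
      (show t ^ 2 - 4 * n = u ^ 2 by omega)
    refine ⟨(a, d), ?_, hs⟩
    rw [Finset.mem_coe, Finset.mem_filter]
    exact ⟨had, by dsimp only; omega⟩
  · rintro ⟨a, d⟩ h
    rw [Finset.mem_filter] at h
    exact (H_of_mem_factorPairs h.1 h.2).symm

theorem sum_H_parabolic (n : ℤ) (hn : 0 < n) :
    ∑ t ∈ Finset.Icc 1 (n + 1) with t ^ 2 = 4 * n, H (4 * n - t ^ 2) =
      ∑ p ∈ factorPairs n, if p.1 = p.2 then (-1 / 12 : ℚ) else 0 := by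
  rw [← Finset.sum_filter]
  symm
  refine Finset.sum_of_injOn (fun p => p.1 + p.2)
    ((add_injOn_factorPairs n).mono fun p h => ?_) ?_ ?_ ?_
  · simp only [Finset.coe_filter, Set.mem_ofPred_eq] at h ⊢
    exact ⟨h.1, h.2.ge⟩
  · rintro ⟨a, d⟩ h
    simp only [Finset.coe_filter, Set.mem_ofPred_eq, Finset.mem_Icc] at h ⊢
    have h1 := add_le_of_mem_factorPairs h.1
    obtain ⟨h2, rfl⟩ := h
    rw [mem_factorPairs] at h2
    exact ⟨⟨by omega, h1⟩, by rw [← h2.2.2]; ring⟩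
  · intro t ht hn'
    rw [Finset.mem_filter, Finset.mem_Icc] at ht
    refine absurd ?_ hn'
    obtain ⟨a, d, had, hs, hu'⟩ := exists_factorPair hn (t := t) (by omega) le_rfl
      (show t ^ 2 - 4 * n = 0 ^ 2 by omega)
    refine ⟨(a, d), ?_, hs⟩
    rw [Finset.mem_coe, Finset.mem_filter]
    exact ⟨had, by dsimp only; omega⟩
  · rintro ⟨a, d⟩ h
    rw [Finset.mem_filter] at h
    have := H_of_mem_factorPairs h.1 h.2.ge
    rw [if_pos h.2] at this
    exact this.symm

/-- A sum of an even function over a symmetric interval, restricted by a condition on squares that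
excludes `0`. -/
theorem sum_Icc_neg_sq {n : ℤ} (P : ℤ → Prop) [DecidablePred P] (h0 : ¬ P 0) (f : ℤ → ℚ) :
    ∑ t ∈ Finset.Icc (-n) n with P (t ^ 2), f (t ^ 2) =
      2 * ∑ t ∈ Finset.Icc 1 n with P (t ^ 2), f (t ^ 2) := by
  have h1 : ∑ t ∈ Finset.Icc (-n) n with P (t ^ 2), f (t ^ 2) =
      ∑ t ∈ Finset.Icc (-n) n with (P (t ^ 2) ∧ 0 < t), f (t ^ 2) +
      ∑ t ∈ Finset.Icc (-n) n with (P (t ^ 2) ∧ ¬ 0 < t), f (t ^ 2) := by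
    rw [← Finset.filter_filter, ← Finset.filter_filter, Finset.sum_filter_add_sum_filter_not]
  have h2 : ∑ t ∈ Finset.Icc (-n) n with (P (t ^ 2) ∧ ¬ 0 < t), f (t ^ 2) =
      ∑ t ∈ Finset.Icc 1 n with P (t ^ 2), f (t ^ 2) := by
    refine Finset.sum_nbij' Neg.neg Neg.neg ?_ ?_ ?_ ?_ ?_ <;> intro t ht <;>
      simp only [Finset.mem_filter, Finset.mem_Icc, neg_sq, neg_neg] at ht ⊢
    · have : t ≠ 0 := by
        rintro rfl
        exact h0 (by simpa using ht.2.1)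
      exact ⟨by omega, ht.2.1⟩
    · exact ⟨by omega, ht.2, by omega⟩
  have h3 : (Finset.Icc (-n) n).filter (fun t => P (t ^ 2) ∧ 0 < t) =
      (Finset.Icc 1 n).filter fun t => P (t ^ 2) := by
    ext t
    simp only [Finset.mem_filter, Finset.mem_Icc]
    constructor
    · rintro ⟨h1, h2, h3⟩
      exact ⟨by omega, h2⟩
    · rintro ⟨h1, h2⟩
      exact ⟨by omega, h2, by omega⟩
  rw [h1, h2, h3]
  ring

theorem filter_sq_lt_eq_ellipticTraces {n : ℤ} (hn : 0 < n) :
    (Finset.Icc (-(n + 1)) (n + 1)).filter (fun t => t ^ 2 < 4 * n) = ellipticTraces n := by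
  ext t
  rw [mem_ellipticTraces, Finset.mem_filter, Finset.mem_Icc, and_iff_right_iff_imp, ← abs_le]
  intro h
  exact abs_le_of_sq_le_sq (by nlinarith [sq_nonneg (n - 1)]) (by omega)

/-- The elliptic traces contribute the sum of `max a d` over `n = a d`, up to a correction for
`a = d`, and the other ones subtract `a - d` whenever `d < a`, which leaves the sum of `d`. -/
theorem sum_H (n : ℤ) (hn : 0 < n) :
    ∑ t ∈ Finset.Icc (-(n + 1)) (n + 1), H (4 * n - t ^ 2) =
      ((∑ p ∈ factorPairs n, p.2 : ℤ) : ℚ) := by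
  have h1 := sum_ellipticTraces n
  have h2 := sum_Icc_neg_sq (n := n + 1) (fun s => ¬ s < 4 * n) (by omega)
    (fun s => H (4 * n - s))
  simp only [not_lt] at h2
  rw [sum_H_pos n hn] at h2
  rw [← Finset.sum_filter_add_sum_filter_not _ (fun t => t ^ 2 < 4 * n),
    filter_sq_lt_eq_ellipticTraces hn]
  simp only [not_lt]
  rw [h2, Finset.sum_filter]
  rw [← Finset.mul_sum] at h1
  have h3 : ((∑ p ∈ factorPairs n, p.2 : ℤ) : ℚ) =
      ((∑ p ∈ factorPairs n, (12 * max p.1 p.2 + if p.1 = p.2 then 2 else 0) : ℤ) : ℚ) / 12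
      + 2 * ∑ p ∈ factorPairs n, if p.2 ≤ p.1 then
        (if p.1 = p.2 then -1 / 12 else -((p.1 - p.2 : ℤ) : ℚ) / 2) else 0 := by
    rw [Int.cast_sum, Int.cast_sum, Finset.sum_div, Finset.mul_sum, ← Finset.sum_add_distrib]
    refine Finset.sum_congr rfl ?_
    rintro ⟨a, d⟩ _
    rcases lt_trichotomy a d with h | h | h
    · simp [h.not_ge, h.ne, max_eq_right h.le]
    · simp [h]
      ring
    · simp [h.le, h.ne']
      ring
  rw [h3, ← h1]
  ring

theorem sum_H_le (n : ℤ) (hn : 0 < n) :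
    ∑ t ∈ Finset.Icc (-(n + 1)) (n + 1) with t ^ 2 ≤ 4 * n, H (4 * n - t ^ 2) =
      ((∑ p ∈ factorPairs n, max p.1 p.2 : ℤ) : ℚ) := by
  have h1 := sum_ellipticTraces n
  have h2 := sum_Icc_neg_sq (n := n + 1) (fun s => s = 4 * n) (by omega)
    (fun s => H (4 * n - s))
  rw [sum_H_parabolic n hn] at h2
  have h3 : ∑ t ∈ Finset.Icc (-(n + 1)) (n + 1) with t ^ 2 ≤ 4 * n, H (4 * n - t ^ 2) =
      ∑ t ∈ Finset.Icc (-(n + 1)) (n + 1) with t ^ 2 < 4 * n, H (4 * n - t ^ 2) +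
      ∑ t ∈ Finset.Icc (-(n + 1)) (n + 1) with t ^ 2 = 4 * n, H (4 * n - t ^ 2) := by
    simp only [Finset.sum_filter, ← Finset.sum_add_distrib]
    refine Finset.sum_congr rfl fun t _ => ?_
    rcases lt_trichotomy (t ^ 2) (4 * n) with h | h | h
    · simp [h, h.le, h.ne]
    · simp [h]
    · simp [h.not_gt, h.not_ge, h.ne']
  rw [h3, h2, filter_sq_lt_eq_ellipticTraces hn]
  rw [← Finset.mul_sum] at h1
  have h4 : ((∑ p ∈ factorPairs n, max p.1 p.2 : ℤ) : ℚ) =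
      ((∑ p ∈ factorPairs n, (12 * max p.1 p.2 + if p.1 = p.2 then 2 else 0) : ℤ) : ℚ) / 12
      + 2 * ∑ p ∈ factorPairs n, if p.1 = p.2 then (-1 / 12 : ℚ) else 0 := by
    rw [Int.cast_sum, Int.cast_sum, Finset.sum_div, Finset.mul_sum, ← Finset.sum_add_distrib]
    refine Finset.sum_congr rfl ?_
    rintro ⟨a, d⟩ _
    by_cases h : a = d
    · simp [h]
      ring
    · simp [h]
  rw [h4, ← h1]
  ring

theorem sum_factorPairs_natCast {M : Type*} [AddCommMonoid M] (n : ℕ) (hn : 1 ≤ n)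
    (f : ℤ → ℤ → M) :
    ∑ p ∈ factorPairs n, f p.1 p.2 = ∑ p ∈ n.divisorsAntidiagonal, f p.1 p.2 := by
  refine Finset.sum_nbij' (fun p => (p.1.toNat, p.2.toNat)) (fun p => ((p.1 : ℤ), (p.2 : ℤ)))
    ?_ ?_ ?_ ?_ ?_ <;> rintro ⟨a, d⟩ h <;>
    simp only [mem_factorPairs, Nat.mem_divisorsAntidiagonal] at h ⊢
  · refine ⟨?_, by omega⟩
    zify
    rw [Int.toNat_of_nonneg h.1.le, Int.toNat_of_nonneg h.2.1.le, h.2.2]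
  · obtain ⟨h1, h2⟩ := h
    subst h1
    have ha : a ≠ 0 := left_ne_zero_of_mul h2
    have hd : d ≠ 0 := right_ne_zero_of_mul h2
    exact ⟨by omega, by omega, by push_cast; rfl⟩
  · rw [Int.toNat_of_nonneg h.1.le, Int.toNat_of_nonneg h.2.1.le]
  · simp
  · rw [Int.toNat_of_nonneg h.1.le, Int.toNat_of_nonneg h.2.1.le]

theorem sum_snd_factorPairs (n : ℕ) (hn : 1 ≤ n) :
    ∑ p ∈ factorPairs n, p.2 = (ArithmeticFunction.sigma 1 n : ℤ) := by
  rw [sum_factorPairs_natCast n hn fun _ d => d, ArithmeticFunction.sigma_one_apply,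
    Nat.cast_sum]
  exact Nat.sum_divisorsAntidiagonal' (f := fun _ d => (d : ℤ))

/-! ### Matrices and their forms -/

/-- The class modulo sign of an integer matrix. -/
def toClass (M : Matrix (Fin 2) (Fin 2) ℤ) : PMat := (M : PMat)

theorem toClass_eq {M N : Matrix (Fin 2) (Fin 2) ℤ} : toClass M = toClass N ↔ M = N ∨ M = -N :=
  Con.eq signCon

theorem toClass_surjective (x : PMat) : ∃ M, toClass M = x := by
  induction x using Con.induction_on with
  | _ M => exact ⟨M, rfl⟩

theorem toClass_neg (M : Matrix (Fin 2) (Fin 2) ℤ) : toClass (-M) = toClass M :=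
  toClass_eq.2 (Or.inr rfl)

theorem det_toClass (M : Matrix (Fin 2) (Fin 2) ℤ) : (toClass M).det = M.det := rfl

theorem trSq_toClass (M : Matrix (Fin 2) (Fin 2) ℤ) : (toClass M).trSq = M.trace ^ 2 := rfl

theorem toClass_mul (M N : Matrix (Fin 2) (Fin 2) ℤ) :
    toClass M * toClass N = toClass (M * N) := rfl

theorem gam_eq {A B : SL(2, ℤ)} : (A : Gam) = (B : Gam) ↔
    (A : Matrix (Fin 2) (Fin 2) ℤ) = B ∨ (A : Matrix (Fin 2) (Fin 2) ℤ) = -B := by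
  constructor
  · intro h
    exact toClass_eq.1 (congrArg toPMat h)
  · rintro (h | h)
    · rw [Subtype.ext h]
    · have h' : A = -B := Subtype.ext h
      rw [QuotientGroup.eq, h', Matrix.SpecialLinearGroup.mem_center_iff]
      refine ⟨-1, by norm_num, ?_⟩
      have e : (-B)⁻¹ * B = -1 := by
        rw [inv_mul_eq_iff_eq_mul]
        simp
      rw [e]
      simp

/-- The form `(x, y) ↦ det (v, M v)`, `v = (x, y)`, of a matrix `M`. -/
def formOf (M : Matrix (Fin 2) (Fin 2) ℤ) : BinForm := ⟨M 1 0, M 1 1 - M 0 0, -M 0 1⟩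

theorem disc_formOf (M : Matrix (Fin 2) (Fin 2) ℤ) :
    (formOf M).disc = M.trace ^ 2 - 4 * M.det := by
  rw [Matrix.trace_fin_two, Matrix.det_fin_two]
  simp only [formOf, BinForm.disc]
  ring

theorem coe_inv_eq (A : SL(2, ℤ)) : ((A⁻¹ : SL(2, ℤ)) : Matrix (Fin 2) (Fin 2) ℤ) =
    !![A 1 1, -A 0 1; -A 1 0, A 0 0] := by
  rw [Matrix.SpecialLinearGroup.coe_inv, Matrix.adjugate_fin_two]

theorem formOf_conj (M : Matrix (Fin 2) (Fin 2) ℤ) (A : SL(2, ℤ)) :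
    formOf ((A⁻¹ : SL(2, ℤ)) * M * A) = (formOf M).comp A := by
  rw [coe_inv_eq]
  ext
  all_goals
    simp only [formOf, BinForm.comp, BinForm.eval, Matrix.mul_apply, Fin.sum_univ_two,
      Matrix.of_apply, Matrix.cons_val', Matrix.cons_val_zero, Matrix.cons_val_one,
      Matrix.cons_val_fin_one]
    ring

theorem trace_conj (M : Matrix (Fin 2) (Fin 2) ℤ) (A : SL(2, ℤ)) :
    ((A⁻¹ : SL(2, ℤ)) * M * (A : Matrix (Fin 2) (Fin 2) ℤ)).trace = M.trace := by
  rw [Matrix.trace_mul_comm, ← mul_assoc, ← Matrix.SpecialLinearGroup.coe_mul, mul_inv_cancel,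
    Matrix.SpecialLinearGroup.coe_one, one_mul]

/-- A matrix is determined by its trace and its form. -/
theorem matrix_ext {M N : Matrix (Fin 2) (Fin 2) ℤ} (ht : M.trace = N.trace)
    (hf : formOf M = formOf N) : M = N := by
  rw [Matrix.trace_fin_two, Matrix.trace_fin_two] at ht
  simp only [formOf, BinForm.mk.injEq] at hf
  ext i j
  fin_cases i <;> fin_cases j <;> dsimp <;> omega

theorem formOf_neg (M : Matrix (Fin 2) (Fin 2) ℤ) :
    formOf (-M) = ⟨-(formOf M).a, -(formOf M).b, -(formOf M).c⟩ := by
  ext <;> simp [formOf]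
  ring

/-- The conjugacy class of an integer matrix of determinant `n`. -/
def conjClass (n : ℕ) (M : Matrix (Fin 2) (Fin 2) ℤ) (h : M.det = n) : ConjClass n :=
  ⟦⟨toClass M, h⟩⟧

theorem conjClass_surjective {n : ℕ} (X : ConjClass n) : ∃ M h, conjClass n M h = X := by
  induction X using Quotient.inductionOn with
  | _ x =>
    obtain ⟨x, hx⟩ := x
    obtain ⟨M, rfl⟩ := toClass_surjective x
    exact ⟨M, hx, rfl⟩

theorem conjClass_eq {n : ℕ} {M N : Matrix (Fin 2) (Fin 2) ℤ} {hM hN} :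
    conjClass n M hM = conjClass n N hN ↔
      ∃ A : SL(2, ℤ), N = (A⁻¹ : SL(2, ℤ)) * M * A ∨ N = -((A⁻¹ : SL(2, ℤ)) * M * A) := by
  constructor
  · intro h
    obtain ⟨g, hg⟩ := Quotient.exact h
    induction g using QuotientGroup.induction_on with
    | _ A =>
      refine ⟨A⁻¹, ?_⟩
      rw [inv_inv]
      exact toClass_eq.1 hg
  · rintro ⟨A, hA⟩
    refine Quotient.sound ⟨((A⁻¹ : SL(2, ℤ)) : Gam), ?_⟩
    exact toClass_eq.2 (by rw [inv_inv]; exact hA)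

theorem conjClass_neg {n : ℕ} {M : Matrix (Fin 2) (Fin 2) ℤ} (h : M.det = n)
    (h' : (-M).det = n) : conjClass n (-M) h' = conjClass n M h :=
  congrArg _ (Subtype.ext (toClass_neg M))

theorem weight_conjClass {n : ℕ} {M : Matrix (Fin 2) (Fin 2) ℤ} (h : M.det = n) :
    (conjClass n M h).weight = weight (toClass M) := rfl

theorem isScalar_toClass {M : Matrix (Fin 2) (Fin 2) ℤ} :
    (toClass M).IsScalar ↔ ∃ a, M = Matrix.scalar (Fin 2) a := by
  constructor
  · rintro ⟨a, ha⟩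
    rcases toClass_eq.1 ha with h | h
    · exact ⟨a, h⟩
    · exact ⟨-a, by rw [h, map_neg]⟩
  · rintro ⟨a, rfl⟩
    exact ⟨a, rfl⟩

theorem sq_trace_of_isScalar {M : Matrix (Fin 2) (Fin 2) ℤ} (h : (toClass M).IsScalar) :
    M.trace ^ 2 = 4 * M.det := by
  obtain ⟨a, rfl⟩ := isScalar_toClass.1 h
  rw [Matrix.scalar_apply, Matrix.trace_fin_two, Matrix.det_fin_two]
  simp only [Matrix.diagonal_apply_eq, Matrix.diagonal_apply_ne _ (zero_ne_one' (Fin 2))]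
  ring

theorem weight_elliptic {M : Matrix (Fin 2) (Fin 2) ℤ} (h : M.trace ^ 2 < 4 * M.det) :
    weight (toClass M) = -1 / (Nat.card (centralizer (toClass M)) : ℚ) := by
  unfold weight
  rw [if_neg fun hs => h.ne (sq_trace_of_isScalar hs), trSq_toClass, det_toClass, if_pos h]

theorem weight_hyperbolic {M : Matrix (Fin 2) (Fin 2) ℤ} {u : ℤ} (hu : 0 < u)
    (h : M.trace ^ 2 - 4 * M.det = u ^ 2) : weight (toClass M) = 1 := by
  have hu2 : 0 < u ^ 2 := by positivity
  unfold weight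
  rw [if_neg fun hs => by have := sq_trace_of_isScalar hs; omega,
    if_neg (by rw [trSq_toClass, det_toClass]; omega), if_pos ⟨u, hu, h⟩]

theorem weight_scalar {M : Matrix (Fin 2) (Fin 2) ℤ} (h : (toClass M).IsScalar) :
    weight (toClass M) = 1 / 6 := by
  unfold weight
  rw [if_pos h]

theorem weight_eq_zero {M : Matrix (Fin 2) (Fin 2) ℤ} (hs : ¬ (toClass M).IsScalar)
    (h : 4 * M.det ≤ M.trace ^ 2) (hu : ¬ ∃ u : ℤ, 0 < u ∧ M.trace ^ 2 - 4 * M.det = u ^ 2) :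
    weight (toClass M) = 0 := by
  unfold weight
  rw [if_neg hs, trSq_toClass, det_toClass, if_neg (not_lt.2 h), if_neg hu]

/-- The matrix of trace `t` and form `f`, which is integral if `t` and `b` have the same parity. -/
def matrixOf (t : ℤ) (f : BinForm) : Matrix (Fin 2) (Fin 2) ℤ :=
  !![(t - f.b) / 2, -f.c; f.a, (t + f.b) / 2]

theorem trace_matrixOf {t n : ℤ} {f : BinForm} (h : f.disc = t ^ 2 - 4 * n) :
    (matrixOf t f).trace = t := by
  obtain ⟨k, hk⟩ := two_dvd_sub_of_disc h
  rw [Matrix.trace_fin_two]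
  simp only [matrixOf, Matrix.of_apply, Matrix.cons_val', Matrix.cons_val_zero, Matrix.cons_val_one,
    Matrix.cons_val_fin_one]
  omega

theorem formOf_matrixOf {t n : ℤ} {f : BinForm} (h : f.disc = t ^ 2 - 4 * n) :
    formOf (matrixOf t f) = f := by
  obtain ⟨k, hk⟩ := two_dvd_sub_of_disc h
  ext <;> simp only [matrixOf, formOf, Matrix.of_apply, Matrix.cons_val', Matrix.cons_val_zero,
    Matrix.cons_val_one, Matrix.cons_val_fin_one] <;> omega

theorem det_matrixOf {t n : ℤ} {f : BinForm} (h : f.disc = t ^ 2 - 4 * n) :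
    (matrixOf t f).det = n := by
  have := disc_formOf (matrixOf t f)
  rw [formOf_matrixOf h, trace_matrixOf h] at this
  omega

theorem matrixOf_trace_formOf (M : Matrix (Fin 2) (Fin 2) ℤ) :
    matrixOf M.trace (formOf M) = M := by
  have h := disc_formOf M
  exact matrix_ext (trace_matrixOf h) (formOf_matrixOf h)

theorem matrixOf_comp {t n : ℤ} {f : BinForm} (h : f.disc = t ^ 2 - 4 * n) (A : SL(2, ℤ)) :
    matrixOf t (f.comp A) = (A⁻¹ : SL(2, ℤ)) * matrixOf t f * A := by
  have h' : (f.comp A).disc = t ^ 2 - 4 * n := by rw [BinForm.disc_comp, h]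
  refine matrix_ext ?_ ?_
  · rw [trace_conj, trace_matrixOf h, trace_matrixOf h']
  · rw [formOf_conj, formOf_matrixOf h, formOf_matrixOf h']

/-- A positive definite form is not the negative of another one. This is why the ambiguity of sign
in `PMat` does no harm to elliptic matrices of given trace. -/
theorem BinForm.PosDef.ne_neg {f f' : BinForm} (hf : f.PosDef) (hf' : f'.PosDef) :
    f ≠ ⟨-f'.a, -f'.b, -f'.c⟩ := by
  intro h
  have h1 := (BinForm.posDef_iff.1 hf).1
  have h2 := (BinForm.posDef_iff.1 hf').1
  rw [h] at h1
  dsimp only at h1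
  omega

/-- The centralizer of an elliptic matrix is the stabilizer of its form. -/
theorem mem_centralizer_matrixOf {t n : ℤ} {f : BinForm} (hf : f.PosDef)
    (h : f.disc = t ^ 2 - 4 * n) (A : SL(2, ℤ)) :
    (A : Gam) ∈ centralizer (toClass (matrixOf t f)) ↔ f.comp A = f := by
  have key : (A : Gam) ∈ centralizer (toClass (matrixOf t f)) ↔
      matrixOf t f = (A⁻¹ : SL(2, ℤ)) * matrixOf t f * A ∨
      matrixOf t f = -((A⁻¹ : SL(2, ℤ)) * matrixOf t f * A) := by
    change toClass A * toClass (matrixOf t f) = toClass (matrixOf t f) * toClass A ↔ _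
    rw [toClass_mul, toClass_mul, toClass_eq]
    have e : ∀ N : Matrix (Fin 2) (Fin 2) ℤ, (A : Matrix (Fin 2) (Fin 2) ℤ) * matrixOf t f = N ↔
        matrixOf t f = (A⁻¹ : SL(2, ℤ)) * N := by
      intro N
      have h1 : ((A⁻¹ : SL(2, ℤ)) : Matrix (Fin 2) (Fin 2) ℤ) * A = 1 := by
        rw [← Matrix.SpecialLinearGroup.coe_mul, inv_mul_cancel, Matrix.SpecialLinearGroup.coe_one]
      have h2 : (A : Matrix (Fin 2) (Fin 2) ℤ) * (A⁻¹ : SL(2, ℤ)) = 1 := by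
        rw [← Matrix.SpecialLinearGroup.coe_mul, mul_inv_cancel, Matrix.SpecialLinearGroup.coe_one]
      constructor
      · rintro rfl
        rw [← mul_assoc, h1, one_mul]
      · intro h
        rw [h, ← mul_assoc, h2, one_mul]
    rw [e, e, mul_neg, mul_assoc]
  rw [key, ← matrixOf_comp h]
  have h' : (f.comp A).disc = t ^ 2 - 4 * n := by rw [BinForm.disc_comp, h]
  constructor
  · rintro (h1 | h1)
    · have := congrArg formOf h1
      rw [formOf_matrixOf h, formOf_matrixOf h'] at this
      exact this.symm
    · have := congrArg formOf h1
      rw [formOf_neg, formOf_matrixOf h, formOf_matrixOf h'] at this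
      exact absurd this (hf.ne_neg (hf.comp A))
  · intro h1
    rw [h1]
    exact Or.inl rfl

/-- The rotation of order three of the modular group that fixes `a (x² + x y + y²)`. -/
def rotU : SL(2, ℤ) := ⟨!![0, -1; 1, 1], by simp [Matrix.det_fin_two]⟩

/-- The inverse of `rotU`, up to sign. -/
def rotV : SL(2, ℤ) := ⟨!![1, 1; -1, 0], by simp [Matrix.det_fin_two]⟩

theorem gam_eq_of_entries {A B : SL(2, ℤ)} {e : ℤ} (he : e = 1 ∨ e = -1)
    (h : ∀ i j, A i j = e * B i j) : (A : Gam) = B := by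
  refine gam_eq.2 ?_
  rcases he with rfl | rfl
  · left
    ext i j
    simpa using h i j
  · right
    ext i j
    simpa using h i j

theorem card_centralizer_of_isReduced {t n : ℤ} {f : BinForm} (hf : f.IsReduced)
    (h : f.disc = t ^ 2 - 4 * n) :
    (1 : ℚ) / Nat.card (centralizer (toClass (matrixOf t f))) =
      if f.b = 0 ∧ f.a = f.c then 1 / 2 else if f.b = f.a ∧ f.a = f.c then 1 / 3 else 1 := by
  have ha := hf.a_pos
  have hmem := mem_centralizer_matrixOf hf.posDef h
  -- the stabilizers, read off entry by entry from the list of substitutions fixing `f`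
  have hent : ∀ A : SL(2, ℤ), (A : Gam) ∈ centralizer (toClass (matrixOf t f)) →
      (A : Gam) = (1 : SL(2, ℤ)) ∨ (f.b = 0 ∧ f.a = f.c) ∧ (A : Gam) = invol ∨
      (f.b = f.a ∧ f.a = f.c) ∧ ((A : Gam) = rotU ∨ (A : Gam) = rotV) := by
    intro A hA
    have hd := det_eq_one A
    have h1 := (hf.eq_of_comp hf ((hmem A).1 hA)).2
    have unit : ∀ {x y : ℤ}, x * y = 1 → (x = 1 ∨ x = -1) ∧ y = x := by
      intro x y hxy
      have := Int.eq_one_or_neg_one_of_mul_eq_one hxy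
      refine ⟨this, ?_⟩
      rcases this with rfl | rfl <;> omega
    rcases h1 with ⟨h1, h2⟩ | ⟨h0, h1, h2⟩ | ⟨h0, ⟨h1, h2⟩ | ⟨h1, h2⟩⟩
    · obtain ⟨h3, h4⟩ := unit (x := A 0 0) (y := A 1 1) (by rw [h1] at hd; linarith)
      refine Or.inl (gam_eq_of_entries h3 ?_)
      intro i j
      fin_cases i <;> fin_cases j <;> simp [h1, h2, h4]
    · obtain ⟨h3, h4⟩ := unit (x := A 1 0) (y := -A 0 1) (by rw [h1] at hd; linarith)
      refine Or.inr (Or.inl ⟨h0, gam_eq_of_entries h3 ?_⟩)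
      have h5 : A 0 1 = -A 1 0 := by omega
      intro i j
      fin_cases i <;> fin_cases j <;> simp [h1, h2, h5, invol]
    · obtain ⟨h3, h4⟩ := unit (x := A 1 0) (y := -A 0 1) (by rw [h1] at hd; linarith)
      refine Or.inr (Or.inr ⟨h0, Or.inl (gam_eq_of_entries h3 ?_)⟩)
      have h5 : A 0 1 = -A 1 0 := by omega
      intro i j
      fin_cases i <;> fin_cases j <;> simp [h1, h2, h5, rotU]
    · obtain ⟨h3, h4⟩ := unit (x := A 0 1) (y := -A 1 0) (by rw [h1] at hd; linarith)
      refine Or.inr (Or.inr ⟨h0, Or.inr (gam_eq_of_entries h3 ?_)⟩)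
      have h5 : A 1 0 = -A 0 1 := by omega
      intro i j
      fin_cases i <;> fin_cases j <;> simp [h1, h2, h5, rotV]
  have hone : ((1 : SL(2, ℤ)) : Gam) ∈ centralizer (toClass (matrixOf t f)) :=
    (hmem 1).2 f.comp_one
  have ne_of : ∀ {A B : SL(2, ℤ)} (i j k l : Fin 2), A i j = 0 → B i j ≠ 0 → (A : Gam) ≠ B := by
    intro A B i j _ _ hA hB hAB
    rcases gam_eq.1 hAB with h | h
    · exact hB (by rw [← hA, h])
    · refine hB ?_
      have := congrFun (congrFun h i) j
      rw [Matrix.neg_apply] at this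
      omega
  rw [← SetLike.coe_sort_coe, Nat.card_coe_set_eq]
  split_ifs with h1 h2
  · have hinv : (invol : Gam) ∈ centralizer (toClass (matrixOf t f)) := by
      refine (hmem invol).2 ?_
      rw [BinForm.comp_invol]
      ext <;> dsimp only <;> omega
    have hS : (centralizer (toClass (matrixOf t f)) : Set Gam) =
        {((1 : SL(2, ℤ)) : Gam), (invol : Gam)} := by
      ext g
      simp only [SetLike.mem_coe, Set.mem_insert_iff, Set.mem_singleton_iff]
      constructor
      · induction g using QuotientGroup.induction_on with
        | _ A =>
          intro hA
          rcases hent A hA with h3 | ⟨-, h3⟩ | ⟨h4, -⟩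
          · exact Or.inl h3
          · exact Or.inr h3
          · omega
      · rintro (rfl | rfl)
        · exact hone
        · exact hinv
    rw [hS, Set.ncard_pair (ne_of (B := invol) 1 0 0 0 (by simp) (by simp [invol]))]
    norm_num
  · obtain ⟨h2, h3⟩ := h2
    have hU : (rotU : Gam) ∈ centralizer (toClass (matrixOf t f)) := by
      refine (hmem rotU).2 ?_
      ext <;> simp [BinForm.comp, BinForm.eval, rotU] <;> omega
    have hV : (rotV : Gam) ∈ centralizer (toClass (matrixOf t f)) := by
      refine (hmem rotV).2 ?_
      ext <;> simp [BinForm.comp, BinForm.eval, rotV] <;> omega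
    have hS : (centralizer (toClass (matrixOf t f)) : Set Gam) =
        {((1 : SL(2, ℤ)) : Gam), (rotU : Gam), (rotV : Gam)} := by
      ext g
      simp only [SetLike.mem_coe, Set.mem_insert_iff, Set.mem_singleton_iff]
      constructor
      · induction g using QuotientGroup.induction_on with
        | _ A =>
          intro hA
          rcases hent A hA with h3 | ⟨h4, -⟩ | ⟨-, h3⟩
          · exact Or.inl h3
          · omega
          · exact Or.inr h3
      · rintro (rfl | rfl | rfl)
        · exact hone
        · exact hU
        · exact hV
    rw [hS, Set.ncard_insert_of_notMem, Set.ncard_pair]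
    · norm_num
    · exact ne_of (B := rotV) 0 0 0 0 (by simp [rotU]) (by simp [rotV])
    · simp only [Set.mem_insert_iff, Set.mem_singleton_iff, not_or]
      exact ⟨ne_of (B := rotU) 1 0 0 0 (by simp) (by simp [rotU]),
        ne_of (B := rotV) 1 0 0 0 (by simp) (by simp [rotV])⟩
  · have hS : (centralizer (toClass (matrixOf t f)) : Set Gam) = {((1 : SL(2, ℤ)) : Gam)} := by
      ext g
      simp only [SetLike.mem_coe, Set.mem_singleton_iff]
      constructor
      · induction g using QuotientGroup.induction_on with
        | _ A =>
          intro hA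
          rcases hent A hA with h3 | ⟨h4, -⟩ | ⟨h4, -⟩
          · exact h3
          · exact absurd h4 h1
          · exact absurd h4 h2
      · rintro rfl
        exact hone
    rw [hS, Set.ncard_singleton]
    norm_num

/-! ### Conjugacy classes of given trace -/

/-- The conjugacy classes of matrices of trace `± t`. -/
def traceClasses (n : ℕ) (t : ℤ) : Set (ConjClass n) := {X | X.trSq = t ^ 2}

theorem conjClass_mem_traceClasses {n : ℕ} {t : ℤ} {M : Matrix (Fin 2) (Fin 2) ℤ} {h : M.det = n} :
    conjClass n M h ∈ traceClasses n t ↔ M.trace = t ∨ M.trace = -t := by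
  rw [← sq_eq_sq_iff_eq_or_eq_neg]
  exact Iff.rfl

theorem det_neg_eq {M : Matrix (Fin 2) (Fin 2) ℤ} : (-M).det = M.det := by
  simp [Matrix.det_fin_two]

/-- A class of matrices of trace `± t` has a member of trace `t`. -/
theorem exists_trace_eq {n : ℕ} {t : ℤ} {X : ConjClass n} (hX : X ∈ traceClasses n t) :
    ∃ M h, conjClass n M h = X ∧ M.trace = t := by
  obtain ⟨M, h, rfl⟩ := conjClass_surjective X
  rcases conjClass_mem_traceClasses.1 hX with ht | ht
  · exact ⟨M, h, rfl, ht⟩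
  · exact ⟨-M, det_neg_eq.trans h, conjClass_neg h _, by rw [Matrix.trace_neg, ht, neg_neg]⟩

section Elliptic

variable {n : ℕ} {t D : ℤ}

/-- The conjugacy class of the matrices with trace `t` and form in a given class. -/
def ellipticClass (h : 4 * n - t ^ 2 = D) (C : FormClass D) : ConjClass n :=
  Quotient.lift (fun f : PosForm D => conjClass n (matrixOf t f.1)
    (det_matrixOf (by rw [f.2.2]; omega))) (by
    rintro ⟨f, hf⟩ ⟨f', hf'⟩ hff'
    obtain ⟨A, rfl⟩ := BinForm.equiv_iff.1 hff'
    exact conjClass_eq.2 ⟨A, Or.inl (matrixOf_comp (n := n) (by rw [hf.2]; omega) A)⟩) C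

theorem ellipticClass_mk (h : 4 * n - t ^ 2 = D) (f : PosForm D) :
    ellipticClass h ⟦f⟧ = conjClass n (matrixOf t f.1)
      (det_matrixOf (by rw [f.2.2]; omega)) := rfl

theorem ellipticClass_eq {s : ℤ} (h : 4 * n - t ^ 2 = D) (h' : 4 * n - s ^ 2 = D)
    {C C' : FormClass D} (he : ellipticClass h C = ellipticClass h' C') : C = C' ∧ t = s := by
  induction C, C' using Quotient.inductionOn₂ with
  | _ f f' =>
    obtain ⟨f, hf⟩ := f
    obtain ⟨f', hf'⟩ := f'
    have hd : f.disc = t ^ 2 - 4 * n := by rw [hf.2]; omega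
    have hd' : f'.disc = s ^ 2 - 4 * n := by rw [hf'.2]; omega
    rw [ellipticClass_mk, ellipticClass_mk] at he
    obtain ⟨A, hA⟩ := conjClass_eq.1 he
    dsimp only at hA
    rw [← matrixOf_comp hd] at hA
    have hdA : (f.comp A).disc = t ^ 2 - 4 * n := by rw [BinForm.disc_comp, hd]
    rcases hA with hA | hA
    · have h1 := congrArg formOf hA
      have h2 := congrArg Matrix.trace hA
      rw [formOf_matrixOf hd', formOf_matrixOf hdA] at h1
      rw [trace_matrixOf hd', trace_matrixOf hdA] at h2
      exact ⟨Quotient.sound (BinForm.equiv_iff.2 ⟨A, h1⟩), h2.symm⟩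
    · have h1 := congrArg formOf hA
      rw [formOf_neg, formOf_matrixOf hd', formOf_matrixOf hdA] at h1
      exact absurd h1 (hf'.1.ne_neg (hf.1.comp A))

theorem ellipticClass_mem (h : 4 * n - t ^ 2 = D) (C : FormClass D) :
    ellipticClass h C ∈ traceClasses n t := by
  induction C using Quotient.inductionOn with
  | _ f =>
    rw [ellipticClass_mk, conjClass_mem_traceClasses]
    exact Or.inl (trace_matrixOf (n := n) (by rw [f.2.2]; omega))

/-- The form of an elliptic matrix is definite; it is positive definite after a change of sign of the
matrix, which turns the trace `t` into `-t`. -/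
theorem traceClasses_eq_union (h : 4 * n - t ^ 2 = D) (h' : 4 * n - (-t) ^ 2 = D) (hD : 0 < D) :
    traceClasses n t = Set.range (ellipticClass h) ∪ Set.range (ellipticClass h') := by
  have key : ∀ {M : Matrix (Fin 2) (Fin 2) ℤ} {hM : M.det = n} {s : ℤ} (hs : 4 * n - s ^ 2 = D),
      M.trace = s → 0 < (formOf M).a → conjClass n M hM ∈ Set.range (ellipticClass hs) := by
    intro M hM s hs ht ha
    have hd := disc_formOf M
    rw [ht, hM] at hd
    refine ⟨⟦⟨formOf M, BinForm.posDef_iff.2 ⟨ha, by omega⟩, by omega⟩⟧, ?_⟩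
    rw [ellipticClass_mk]
    congr 1
    have := matrixOf_trace_formOf M
    rwa [ht] at this
  apply Set.Subset.antisymm
  · intro X hX
    obtain ⟨M, hM, rfl, ht⟩ := exists_trace_eq hX
    have hd := disc_formOf M
    rw [ht, hM] at hd
    have ha : (formOf M).a ≠ 0 := by
      intro h0
      rw [BinForm.disc, h0] at hd
      nlinarith [sq_nonneg (formOf M).b]
    rcases ha.lt_or_gt with ha | ha
    · right
      rw [← conjClass_neg hM (det_neg_eq.trans hM)]
      refine key h' (by rw [Matrix.trace_neg, ht]) ?_
      rw [formOf_neg]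
      dsimp only
      omega
    · exact Or.inl (key h ht ha)
  · rintro X (⟨C, rfl⟩ | ⟨C, rfl⟩)
    · exact ellipticClass_mem h C
    · have := ellipticClass_mem h' C
      rwa [traceClasses, neg_sq] at this

theorem weight_ellipticClass (h : 4 * n - t ^ 2 = D) (hD : 0 < D) (C : FormClass D) :
    (ellipticClass h C).weight = -C.mult := by
  obtain ⟨⟨⟨a, b, c⟩, hp⟩, rfl⟩ := (classOfReduced_bijective D).2 C
  rw [mult_classOfReduced, classOfReduced, ellipticClass_mk, weight_conjClass]
  obtain ⟨h1, h2⟩ := mem_reducedForms.1 hp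
  have hd : (⟨a, b, c⟩ : BinForm).disc = t ^ 2 - 4 * n := by omega
  dsimp only
  rw [weight_elliptic (by rw [trace_matrixOf hd, det_matrixOf hd]; omega), neg_div,
    card_centralizer_of_isReduced h1 hd]

theorem finite_traceClasses_elliptic (hD : 0 < 4 * n - t ^ 2) : (traceClasses n t).Finite := by
  have := finite_formClass (4 * n - t ^ 2)
  rw [traceClasses_eq_union rfl (by rw [neg_sq]) hD]
  exact (Set.finite_range _).union (Set.finite_range _)

theorem finsum_traceClasses_elliptic (hD : 0 < 4 * n - t ^ 2) :
    ∑ᶠ X ∈ traceClasses n t, X.weight =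
      if t = 0 then -H (4 * n - t ^ 2) else -2 * H (4 * n - t ^ 2) := by
  have hfin := finite_formClass (4 * n - t ^ 2)
  have hrange : ∀ (s : ℤ) (h : 4 * (n : ℤ) - s ^ 2 = 4 * n - t ^ 2),
      ∑ᶠ X ∈ Set.range (ellipticClass h), X.weight = -H (4 * n - t ^ 2) := by
    intro s h
    rw [finsum_mem_range fun C C' hC => (ellipticClass_eq h h hC).1, H, if_pos hD,
      ← finsum_neg_distrib]
    exact finsum_congr fun C => weight_ellipticClass h hD C
  have h' : 4 * (n : ℤ) - (-t) ^ 2 = 4 * n - t ^ 2 := by rw [neg_sq]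
  rw [traceClasses_eq_union rfl h' hD]
  split_ifs with ht
  · subst ht
    have : Set.range (ellipticClass h') = Set.range (ellipticClass (n := n) (t := 0) rfl) := by
      congr 1
    rw [this, Set.union_self, hrange]
  · rw [finsum_mem_union _ (Set.finite_range _) (Set.finite_range _), hrange, hrange]
    · ring
    · rw [Set.disjoint_left]
      rintro X ⟨C, rfl⟩ ⟨C', hC'⟩
      have := (ellipticClass_eq _ _ hC').2
      omega

end Elliptic

section Hyperbolic

variable {n : ℕ}

/-- An integer vector is a multiple of the first column of a matrix of determinant one. -/
theorem exists_first_column {v w : ℤ} (h : v ≠ 0 ∨ w ≠ 0) :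
    ∃ (A : SL(2, ℤ)) (k : ℤ), k ≠ 0 ∧ v = k * A 0 0 ∧ w = k * A 1 0 := by
  have hg : (Int.gcd v w : ℤ) ≠ 0 := by
    rw [Ne, Int.natCast_eq_zero, Int.gcd_eq_zero_iff]
    omega
  obtain ⟨p, hp⟩ := Int.gcd_dvd_left v w
  obtain ⟨r, hr⟩ := Int.gcd_dvd_right v w
  have hbez := Int.gcd_eq_gcd_ab v w
  have h1 : p * Int.gcdA v w + r * Int.gcdB v w = 1 := by
    refine mul_left_cancel₀ hg ?_
    linear_combination -hbez - Int.gcdA v w * hp - Int.gcdB v w * hr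
  refine ⟨⟨!![p, -Int.gcdB v w; r, Int.gcdA v w], ?_⟩, Int.gcd v w, hg, ?_, ?_⟩
  · rw [Matrix.det_fin_two_of]
    linarith
  · simpa using hp
  · simpa using hr

/-- A matrix with an integral eigenvalue `a` is conjugate to an upper triangular one. -/
theorem exists_conj_upperTriangular (M : Matrix (Fin 2) (Fin 2) ℤ) {a : ℤ}
    (ha : a ^ 2 - M.trace * a + M.det = 0) :
    ∃ (A : SL(2, ℤ)) (b : ℤ),
      (A⁻¹ : SL(2, ℤ)) * M * (A : Matrix (Fin 2) (Fin 2) ℤ) = !![a, b; 0, M.trace - a] := by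
  rw [Matrix.trace_fin_two, Matrix.det_fin_two] at ha
  obtain ⟨v, w, hvw, h1, h2⟩ : ∃ v w : ℤ, (v ≠ 0 ∨ w ≠ 0) ∧
      M 0 0 * v + M 0 1 * w = a * v ∧ M 1 0 * v + M 1 1 * w = a * w := by
    by_cases h : M 0 1 ≠ 0 ∨ a - M 0 0 ≠ 0
    · exact ⟨M 0 1, a - M 0 0, h, by ring, by linear_combination -ha⟩
    -- if the first row of `M - a` vanishes, the second one gives an eigenvector
    · push Not at h
      by_cases h' : M 1 0 ≠ 0 ∨ a - M 1 1 ≠ 0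
      · exact ⟨a - M 1 1, M 1 0, h'.symm, by linear_combination -ha, by ring⟩
      · push Not at h'
        refine ⟨1, 0, Or.inl one_ne_zero, ?_, ?_⟩
        · rw [h.1]
          linarith [h.2]
        · rw [h'.1]
          ring
  obtain ⟨A, k, hk, rfl, rfl⟩ := exists_first_column hvw
  have e1 : M 0 0 * A 0 0 + M 0 1 * A 1 0 = a * A 0 0 :=
    mul_left_cancel₀ hk (by linear_combination h1)
  have e2 : M 1 0 * A 0 0 + M 1 1 * A 1 0 = a * A 1 0 :=
    mul_left_cancel₀ hk (by linear_combination h2)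
  have hd := det_eq_one A
  have ht := trace_conj M A
  set N := (A⁻¹ : SL(2, ℤ)) * M * (A : Matrix (Fin 2) (Fin 2) ℤ) with hN
  have h00 : N 0 0 = a := by
    rw [hN, coe_inv_eq]
    simp only [Matrix.mul_apply, Fin.sum_univ_two, Matrix.of_apply, Matrix.cons_val',
      Matrix.cons_val_zero, Matrix.cons_val_one, Matrix.cons_val_fin_one]
    linear_combination A 1 1 * e1 - A 0 1 * e2 + a * hd
  have h10 : N 1 0 = 0 := by
    rw [hN, coe_inv_eq]
    simp only [Matrix.mul_apply, Fin.sum_univ_two, Matrix.of_apply, Matrix.cons_val',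
      Matrix.cons_val_zero, Matrix.cons_val_one, Matrix.cons_val_fin_one]
    linear_combination A 0 0 * e2 - A 1 0 * e1
  refine ⟨A, N 0 1, ?_⟩
  have h11 : N 1 1 = M.trace - a := by
    rw [← ht, Matrix.trace_fin_two, h00, add_sub_cancel_left]
  have := Matrix.eta_fin_two N
  rwa [h00, h10, h11] at this

variable {a d : ℤ}

/-- The class of the upper triangular matrix `(a, b; 0, d)`, where `a d = n`. -/
def triangularClass (h : a * d = n) (b : ℤ) : ConjClass n :=
  conjClass n !![a, b; 0, d] (by rw [Matrix.det_fin_two_of]; linarith)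

theorem triangularClass_add_mul (h : a * d = n) (b k : ℤ) :
    triangularClass h (b + k * (a - d)) = triangularClass h b := by
  refine (conjClass_eq.2 ⟨transl k, Or.inl ?_⟩).symm
  rw [coe_inv_eq]
  ext i j
  fin_cases i <;> fin_cases j <;> simp [transl, Matrix.mul_apply, Fin.sum_univ_two]
  ring

theorem triangularClass_injOn (h : a * d = n) (had : d < a) (hd : 0 < d) :
    Set.InjOn (triangularClass h) (Set.Ico 0 (a - d)) := by
  intro b hb b' hb' he
  obtain ⟨A, hA⟩ := conjClass_eq.1 he
  rcases hA with hA | hA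
  · have hc : (A : Matrix (Fin 2) (Fin 2) ℤ) * !![a, b'; 0, d] = !![a, b; 0, d] * A := by
      rw [hA, ← mul_assoc, ← mul_assoc, ← Matrix.SpecialLinearGroup.coe_mul, mul_inv_cancel,
        Matrix.SpecialLinearGroup.coe_one, one_mul]
    have h10 := congrFun (congrFun hc 1) 0
    have h01 := congrFun (congrFun hc 0) 1
    simp [Matrix.mul_apply, Fin.sum_univ_two] at h10 h01
    have hr : A 1 0 = 0 := by
      have h1 : A 1 0 * (a - d) = 0 := by linear_combination h10
      exact (mul_eq_zero.1 h1).resolve_right (by omega)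
    have hdet := det_eq_one A
    rw [hr, mul_zero, sub_zero] at hdet
    have h00 := Int.eq_one_or_neg_one_of_mul_eq_one hdet
    have hps : A 1 1 = A 0 0 := by
      rcases h00 with h0 | h0 <;> rw [h0] at hdet ⊢ <;> omega
    rw [hps] at h01
    have h2 : b' - b = A 0 0 * A 0 1 * (a - d) := by
      have h3 : A 0 0 * A 0 0 = 1 := by rwa [hps] at hdet
      linear_combination A 0 0 * h01 - (b' - b) * h3
    obtain ⟨hb1, hb2⟩ := hb
    obtain ⟨hb1', hb2'⟩ := hb'
    have h3 : A 0 0 * A 0 1 = 0 := by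
      have h4 : A 0 0 * A 0 1 < 1 := by nlinarith
      have h5 : -1 < A 0 0 * A 0 1 := by nlinarith
      omega
    rw [h3] at h2
    omega
  -- the opposite matrix has the wrong trace, as `a + d` is positive
  · have ht := congrArg Matrix.trace hA
    rw [Matrix.trace_neg, trace_conj, Matrix.trace_fin_two_of, Matrix.trace_fin_two_of] at ht
    omega

/-- Conjugation by translations reduces `b` modulo `a - d`. -/
theorem traceClasses_eq_image (h : a * d = n) (had : d < a) :
    traceClasses n (a + d) = triangularClass h '' Set.Ico 0 (a - d) := by
  apply Set.Subset.antisymm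
  · intro X hX
    obtain ⟨M, hM, rfl, ht⟩ := exists_trace_eq hX
    obtain ⟨A, b, hA⟩ := exists_conj_upperTriangular M (a := a)
      (by rw [ht, hM, ← h]; ring)
    rw [ht, add_sub_cancel_left] at hA
    have e : conjClass n M hM = triangularClass h b := conjClass_eq.2 ⟨A, Or.inl hA.symm⟩
    refine ⟨b % (a - d), ⟨Int.emod_nonneg _ (by omega), Int.emod_lt_of_pos _ (by omega)⟩, ?_⟩
    rw [e, ← triangularClass_add_mul h (b % (a - d)) (b / (a - d)), mul_comm,
      Int.emod_add_mul_ediv]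
  · rintro X ⟨b, -, rfl⟩
    refine conjClass_mem_traceClasses.2 (Or.inl ?_)
    rw [Matrix.trace_fin_two_of]

theorem finsum_traceClasses_hyperbolic (h : a * d = n) (had : d < a) (hd : 0 < d) :
    (traceClasses n (a + d)).Finite ∧
      ∑ᶠ X ∈ traceClasses n (a + d), X.weight = ((a - d : ℤ) : ℚ) := by
  have himg := traceClasses_eq_image h had
  constructor
  · rw [himg]
    exact (Set.finite_Ico _ _).image _
  · have h1 : ∀ X ∈ traceClasses n (a + d), X.weight = 1 := by
      intro X hX
      obtain ⟨M, hM, rfl, ht⟩ := exists_trace_eq hX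
      rw [weight_conjClass]
      exact weight_hyperbolic (u := a - d) (by omega) (by rw [ht, hM, ← h]; ring)
    rw [finsum_mem_congr rfl h1, himg, finsum_mem_image (triangularClass_injOn h had hd),
      ← Finset.coe_Ico, finsum_mem_coe_finset, Finset.sum_const, Int.card_Ico, sub_zero,
      nsmul_one]
    have : ((a - d).toNat : ℤ) = a - d := Int.toNat_of_nonneg (by omega)
    exact_mod_cast this

end Hyperbolic

section Parabolic

variable {n : ℕ}

/-- The class of a scalar matrix. -/
def scalarClass {m : ℤ} (h : m ^ 2 = n) : ConjClass n :=
  conjClass n (Matrix.scalar (Fin 2) m) (by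
    rw [Matrix.scalar_apply, Matrix.det_fin_two]
    simp only [Matrix.diagonal_apply_eq, Matrix.diagonal_apply_ne _ (zero_ne_one' (Fin 2))]
    linarith)

theorem trace_scalar (m : ℤ) : (Matrix.scalar (Fin 2) m : Matrix (Fin 2) (Fin 2) ℤ).trace =
    2 * m := by
  rw [Matrix.scalar_apply, Matrix.trace_fin_two]
  simp only [Matrix.diagonal_apply_eq]
  ring

/-- The scalar matrix is the only one of trace `2 m` and determinant `m²` of nonzero weight. -/
theorem finsum_traceClasses_parabolic {m : ℤ} (h : m ^ 2 = n) :
    (traceClasses n (2 * m) ∩ {X | X.weight ≠ 0}).Finite ∧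
      ∑ᶠ X ∈ traceClasses n (2 * m), X.weight = 1 / 6 := by
  have hS : traceClasses n (2 * m) ∩ {X | X.weight ≠ 0} = {scalarClass h} := by
    ext X
    simp only [Set.mem_inter_iff, Set.mem_ofPred_eq, Set.mem_singleton_iff]
    constructor
    · rintro ⟨hX, hw⟩
      obtain ⟨M, hM, rfl, ht⟩ := exists_trace_eq hX
      by_cases hs : (toClass M).IsScalar
      · obtain ⟨a, rfl⟩ := isScalar_toClass.1 hs
        rw [trace_scalar] at ht
        obtain rfl : a = m := by omega
        rfl
      · refine absurd (weight_eq_zero hs ?_ ?_) hw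
        · rw [ht, hM, ← h]
          linarith
        · rintro ⟨u, hu, he⟩
          rw [ht, hM, ← h] at he
          nlinarith
    · rintro rfl
      refine ⟨conjClass_mem_traceClasses.2 (Or.inl (trace_scalar m)), ?_⟩
      rw [scalarClass, weight_conjClass, weight_scalar ⟨m, rfl⟩]
      norm_num
  refine ⟨hS ▸ Set.finite_singleton _, ?_⟩
  have h1 := finsum_mem_inter_support (fun X : ConjClass n => X.weight) (traceClasses n (2 * m))
  rw [← h1]
  change ∑ᶠ X ∈ traceClasses n (2 * m) ∩ {X | X.weight ≠ 0}, X.weight = _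
  rw [hS, finsum_mem_singleton]
  exact weight_scalar ⟨m, rfl⟩

end Parabolic

theorem traceClasses_neg (n : ℕ) (t : ℤ) : traceClasses n (-t) = traceClasses n t := by
  rw [traceClasses, neg_sq, traceClasses]

theorem finsum_traceClasses {n : ℕ} (hn : 0 < n) (t : ℤ) :
    (traceClasses n t ∩ {X | X.weight ≠ 0}).Finite ∧
      ∑ᶠ X ∈ traceClasses n t, X.weight =
        if t = 0 then -H (4 * n - t ^ 2) else -2 * H (4 * n - t ^ 2) := by
  rcases lt_trichotomy (4 * (n : ℤ) - t ^ 2) 0 with hD | hD | hD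
  · have ht : t ≠ 0 := by
      rintro rfl
      omega
    rw [if_neg ht]
    wlog hpos : 0 < t generalizing t
    · have := this (-t) (by rwa [neg_sq]) (by omega) (by omega)
      rwa [traceClasses_neg, neg_sq] at this
    by_cases hu : ∃ u : ℤ, 0 < u ∧ t ^ 2 - 4 * n = u ^ 2
    · obtain ⟨u, hu, he⟩ := hu
      obtain ⟨a, d, had, rfl, rfl⟩ := exists_factorPair (n := n) (by omega) hpos.le hu.le he
      have had' := mem_factorPairs.1 had
      obtain ⟨h1, h2⟩ := finsum_traceClasses_hyperbolic had'.2.2 (by omega) had'.2.1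
      refine ⟨h1.inter_of_left _, ?_⟩
      rw [h2, H_of_mem_factorPairs had (by omega), if_neg (by omega)]
      ring
    · have h0 : ∀ X ∈ traceClasses n t, X.weight = 0 := by
        intro X hX
        obtain ⟨M, hM, rfl, ht⟩ := exists_trace_eq hX
        refine weight_eq_zero (fun hs => ?_) ?_ ?_
        · have := sq_trace_of_isScalar hs
          rw [ht, hM] at this
          omega
        · rw [ht, hM]
          omega
        · rwa [ht, hM]
      have hH : H (4 * n - t ^ 2) = 0 := by
        by_contra hne
        obtain ⟨u, hu', he⟩ := exists_sq_of_H_ne_zero hD hne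
        exact hu ⟨u, hu', by omega⟩
      constructor
      · convert Set.finite_empty
        ext X
        simp only [Set.mem_inter_iff, Set.mem_ofPred_eq, Set.mem_empty_iff_false, iff_false]
        exact fun hX => hX.2 (h0 X hX.1)
      · rw [finsum_mem_congr rfl h0, finsum_mem_zero, hH, mul_zero]
  · have ht : t ≠ 0 := by
      rintro rfl
      omega
    obtain ⟨m, rfl⟩ : (2 : ℤ) ∣ t := by
      have : (2 : ℤ) ∣ t ^ 2 := ⟨2 * n, by omega⟩
      exact Int.prime_two.dvd_of_dvd_pow this
    obtain ⟨h1, h2⟩ := finsum_traceClasses_parabolic (n := n) (m := m) (by linarith)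
    refine ⟨h1, ?_⟩
    rw [if_neg ht, h2, hD, H_zero]
    norm_num
  · exact ⟨(finite_traceClasses_elliptic hD).inter_of_left _, finsum_traceClasses_elliptic hD⟩

theorem abs_trace_le_of_weight_ne_zero {n : ℕ} (hn : 0 < n) {M : Matrix (Fin 2) (Fin 2) ℤ}
    {h : M.det = n} (hw : (conjClass n M h).weight ≠ 0) : |M.trace| ≤ n + 1 := by
  by_cases hle : M.trace ^ 2 ≤ 4 * n
  · exact abs_le_of_sq_le_sq (by nlinarith [sq_nonneg ((n : ℤ) - 1)]) (by omega)
  · by_cases hu : ∃ u : ℤ, 0 < u ∧ M.trace ^ 2 - 4 * M.det = u ^ 2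
    · obtain ⟨u, hu, he⟩ := hu
      obtain ⟨a, d, had, hs, -⟩ := exists_factorPair (n := n) (by omega) (abs_nonneg M.trace) hu.le
        (by rw [sq_abs, ← h, he])
      exact hs ▸ add_le_of_mem_factorPairs had
    · refine absurd (weight_eq_zero (fun hs => hle ?_) ?_ hu) hw
      · rw [sq_trace_of_isScalar hs, h]
      · rw [h]
        omega

/-- The classes of trace `± t` are summed over `t ≥ 0`; the factor `2` for `t ≠ 0` accounts for the
negative `t`. -/
theorem finsum_weight {n : ℕ} (hn : 0 < n) :
    {X : ConjClass n | X.weight ≠ 0}.Finite ∧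
      ∑ᶠ X : ConjClass n, X.weight =
        -∑ t ∈ Finset.Icc (-((n : ℤ) + 1)) (n + 1), H (4 * n - t ^ 2) := by
  let I : Finset ℤ := Finset.Icc 0 ((n : ℤ) + 1)
  let S : ℤ → Set (ConjClass n) := fun t => traceClasses n t ∩ {X | X.weight ≠ 0}
  have hcover : {X : ConjClass n | X.weight ≠ 0} = ⋃ t ∈ (I : Set ℤ), S t := by
    ext X
    simp only [Set.mem_ofPred_eq, Set.mem_iUnion, exists_prop, S, Set.mem_inter_iff]
    constructor
    · intro hX
      obtain ⟨M, hM, rfl⟩ := conjClass_surjective X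
      refine ⟨|M.trace|, ?_, conjClass_mem_traceClasses.2 ?_, hX⟩
      · rw [Finset.mem_coe, Finset.mem_Icc]
        exact ⟨abs_nonneg _, abs_trace_le_of_weight_ne_zero hn hX⟩
      · rcases abs_choice M.trace with h | h <;> omega
    · rintro ⟨t, -, -, hX⟩
      exact hX
  have hfin : ∀ t ∈ (I : Set ℤ), (S t).Finite := fun t _ => (finsum_traceClasses hn t).1
  have hdisj : (I : Set ℤ).PairwiseDisjoint S := by
    intro s hs t ht hst
    refine Set.disjoint_left.2 fun X hXs hXt => hst ?_
    have h1 : s ^ 2 = t ^ 2 := hXs.1.symm.trans hXt.1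
    rw [Finset.mem_coe, Finset.mem_Icc] at hs ht
    exact (sq_eq_sq₀ hs.1 ht.1).1 h1
  constructor
  · rw [hcover]
    exact I.finite_toSet.biUnion hfin
  · have h1 : ∑ᶠ X : ConjClass n, X.weight = ∑ᶠ X ∈ {X : ConjClass n | X.weight ≠ 0}, X.weight :=
      (finsum_mem_support _).symm
    have h2 : ∀ t : ℤ, ∑ᶠ X ∈ S t, X.weight =
        if t = 0 then -H (4 * n - t ^ 2) else -2 * H (4 * n - t ^ 2) := fun t =>
      (finsum_mem_inter_support _ _).trans (finsum_traceClasses hn t).2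
    rw [h1, hcover, finsum_mem_biUnion hdisj I.finite_toSet hfin, finsum_mem_coe_finset,
      Finset.sum_congr rfl fun t _ => h2 t]
    have h3 := sum_Icc_neg_sq (n := (n : ℤ) + 1) (fun s => s ≠ 0) (by simp)
      (fun s => H (4 * n - s))
    have h4 := Finset.sum_filter_add_sum_filter_not (Finset.Icc (-((n : ℤ) + 1)) (n + 1))
      (fun t => t ^ 2 ≠ 0) (fun t => H (4 * n - t ^ 2))
    have h5 : (Finset.Icc (-((n : ℤ) + 1)) (n + 1)).filter (fun t => ¬ t ^ 2 ≠ 0) = {0} := by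
      ext t
      simp only [Finset.mem_filter, Finset.mem_Icc, not_not, Finset.mem_singleton, sq_eq_zero_iff]
      omega
    have h6 : (Finset.Icc (1 : ℤ) (n + 1)).filter (fun t => t ^ 2 ≠ 0) =
        Finset.Icc 1 ((n : ℤ) + 1) := by
      refine Finset.filter_true_of_mem fun t ht => ?_
      rw [Finset.mem_Icc] at ht
      exact pow_ne_zero _ (by omega)
    have h7 : I = insert 0 (Finset.Icc 1 ((n : ℤ) + 1)) := by
      ext t
      simp only [I, Finset.mem_Icc, Finset.mem_insert]
      omega
    rw [h5, Finset.sum_singleton, h3, h6] at h4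
    rw [h7, Finset.sum_insert (by simp), if_pos rfl, ← h4]
    have h8 : ∑ t ∈ Finset.Icc (1 : ℤ) (n + 1),
        (if t = 0 then -H (4 * n - t ^ 2) else -2 * H (4 * n - t ^ 2)) =
        -2 * ∑ t ∈ Finset.Icc (1 : ℤ) (n + 1), H (4 * n - t ^ 2) := by
      rw [Finset.mul_sum]
      refine Finset.sum_congr rfl fun t ht => ?_
      rw [Finset.mem_Icc] at ht
      rw [if_neg (by omega)]
    rw [h8]
    ring

/-! ### Hermite normal forms -/

section Hermite

variable {n : ℕ}

/-- The class of an integer matrix modulo sign and left multiplication. -/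
def leftClass (n : ℕ) (M : Matrix (Fin 2) (Fin 2) ℤ) (h : M.det = n) : LeftQuot n :=
  Quotient.mk (MulAction.orbitRel Gam (HMat n)) ⟨toClass M, h⟩

theorem leftClass_surjective (X : LeftQuot n) : ∃ M h, leftClass n M h = X := by
  induction X using Quotient.inductionOn with
  | _ x =>
    obtain ⟨x, hx⟩ := x
    obtain ⟨M, rfl⟩ := toClass_surjective x
    exact ⟨M, hx, rfl⟩

theorem leftClass_eq {M N : Matrix (Fin 2) (Fin 2) ℤ} {hM hN} :
    leftClass n M hM = leftClass n N hN ↔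
      ∃ A : SL(2, ℤ), (A : Matrix (Fin 2) (Fin 2) ℤ) * N = M ∨
        (A : Matrix (Fin 2) (Fin 2) ℤ) * N = -M := by
  constructor
  · intro h
    obtain ⟨g, hg⟩ := MulAction.orbitRel_apply.1 (Quotient.exact h)
    induction g using QuotientGroup.induction_on with
    | _ A => exact ⟨A, toClass_eq.1 (congrArg Subtype.val hg)⟩
  · rintro ⟨A, hA⟩
    exact Quotient.sound (MulAction.orbitRel_apply.2 ⟨(A : Gam), Subtype.ext (toClass_eq.2 hA)⟩)

theorem leftClass_neg {M : Matrix (Fin 2) (Fin 2) ℤ} (h : M.det = n) (h' : (-M).det = n) :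
    leftClass n (-M) h' = leftClass n M h :=
  congrArg _ (Subtype.ext (toClass_neg M))

/-- The indices `((a, d), b)` of the Hermite normal forms `(a, b; 0, d)` of determinant `n`. -/
def hermiteIndex (n : ℤ) : Finset (Σ _ : ℤ × ℤ, ℤ) :=
  (factorPairs n).sigma fun p => Finset.Ico 0 p.2

theorem mem_hermiteIndex {n a d b : ℤ} : (⟨(a, d), b⟩ : Σ _ : ℤ × ℤ, ℤ) ∈ hermiteIndex n ↔
    (0 < a ∧ 0 < d ∧ a * d = n) ∧ 0 ≤ b ∧ b < d := by
  rw [hermiteIndex, Finset.mem_sigma, mem_factorPairs, Finset.mem_Ico]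

/-- The left class of a Hermite normal form. -/
def hermiteClass (n : ℕ) (q : hermiteIndex n) : LeftQuot n :=
  leftClass n !![q.1.1.1, q.1.2; 0, q.1.1.2] (by
    obtain ⟨⟨⟨a, d⟩, b⟩, hq⟩ := q
    rw [Matrix.det_fin_two_of, mul_zero, sub_zero]
    exact (mem_hermiteIndex.1 hq).1.2.2)

theorem hermiteClass_injective (n : ℕ) : Function.Injective (hermiteClass n) := by
  rintro ⟨⟨⟨a, d⟩, b⟩, hq⟩ ⟨⟨⟨a', d'⟩, b'⟩, hq'⟩ he
  obtain ⟨A, hA⟩ := leftClass_eq.1 he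
  obtain ⟨⟨ha, hd, -⟩, hb, hbd⟩ := mem_hermiteIndex.1 hq
  obtain ⟨⟨ha', hd', -⟩, hb', hbd'⟩ := mem_hermiteIndex.1 hq'
  obtain ⟨e, hee, h⟩ : ∃ e : ℤ, e * e = 1 ∧
      (A : Matrix (Fin 2) (Fin 2) ℤ) * !![a', b'; 0, d'] = e • !![a, b; 0, d] := by
    rcases hA with hA | hA
    · exact ⟨1, by norm_num, by rw [one_smul]; exact hA⟩
    · exact ⟨-1, by norm_num, by rw [neg_one_smul]; exact hA⟩
  have h00 := congrFun (congrFun h 0) 0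
  have h10 := congrFun (congrFun h 1) 0
  have h01 := congrFun (congrFun h 0) 1
  have h11 := congrFun (congrFun h 1) 1
  have hdet := det_eq_one A
  simp only [Matrix.mul_apply, Fin.sum_univ_two, Matrix.smul_apply, smul_eq_mul, Matrix.of_apply,
    Matrix.cons_val', Matrix.cons_val_zero, Matrix.cons_val_one, Matrix.cons_val_fin_one, mul_zero,
    add_zero] at h00 h10 h01 h11
  generalize A 0 0 = p at *
  generalize A 0 1 = q at *
  generalize A 1 0 = r at *
  generalize A 1 1 = s at *
  have hr : r = 0 := (mul_eq_zero.1 h10).resolve_right ha'.ne'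
  subst hr
  rw [mul_zero, sub_zero] at hdet
  -- `e p = e s` is a positive unit, hence `1`
  have h1 : (e * p) * a' = a := by linear_combination e * h00 + a * hee
  have h2 : (e * p) * (e * s) = 1 := by linear_combination p * s * hee + hdet
  have hep : 0 < e * p := by
    by_contra! hneg
    have := mul_nonpos_of_nonpos_of_nonneg hneg ha'.le
    omega
  have hep1 : e * p = 1 := by
    rcases Int.eq_one_or_neg_one_of_mul_eq_one h2 with h | h <;> omega
  rw [hep1, one_mul] at h1 h2
  have h3 : d' = d := by linear_combination e * h11 + d * hee - d' * h2
  have h4 : b' + e * q * d' = b := by linear_combination e * h01 + b * hee - b' * hep1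
  subst h1 h3
  have h5 : e * q = 0 := by
    have h6 : e * q < 1 := by nlinarith
    have h7 : -1 < e * q := by nlinarith
    omega
  rw [h5, zero_mul, add_zero] at h4
  subst h4
  rfl

theorem hermiteClass_surjective (hn : 0 < n) : Function.Surjective (hermiteClass n) := by
  intro X
  obtain ⟨M, hM, rfl⟩ := leftClass_surjective X
  have hdet := hM
  rw [Matrix.det_fin_two] at hdet
  have hcol : M 0 0 ≠ 0 ∨ M 1 0 ≠ 0 := by
    by_contra! h
    rw [h.1, h.2] at hdet
    omega
  -- the first column is made `(k, 0)` with `k > 0`, then `b` is reduced modulo `d`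
  obtain ⟨A, k, hk, hv, hw⟩ := exists_first_column hcol
  wlog hpos : 0 < k generalizing M k
  · have hM' : (-M).det = n := det_neg_eq.trans hM
    obtain ⟨q, hq⟩ := this (-M) hM' (by rw [← Matrix.det_fin_two, hM'])
      (by simpa using hcol) (-k) (by omega)
      (by rw [Matrix.neg_apply, hv]; ring) (by rw [Matrix.neg_apply, hw]; ring) (by omega)
    exact ⟨q, hq.trans (leftClass_neg hM hM')⟩
  have hd := det_eq_one A
  set b := A 1 1 * M 0 1 - A 0 1 * M 1 1 with hb
  set d := A 0 0 * M 1 1 - A 1 0 * M 0 1 with hd'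
  have hkd : k * d = n := by
    rw [← hdet, hv, hw, hd']
    ring
  have hd0 : 0 < d := by
    refine (mul_pos_iff_of_pos_left hpos).1 ?_
    omega
  refine ⟨⟨⟨(k, d), b % d⟩, mem_hermiteIndex.2 ⟨⟨hpos, hd0, hkd⟩,
    Int.emod_nonneg _ hd0.ne', Int.emod_lt_of_pos _ hd0⟩⟩, ?_⟩
  refine leftClass_eq.2 ⟨transl (-(b / d)) * A⁻¹, Or.inl ?_⟩
  have hbd : b % d = b - b / d * d := by
    have := Int.emod_add_mul_ediv b d
    linarith
  dsimp only
  rw [hbd, Matrix.SpecialLinearGroup.coe_mul, coe_inv_eq]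
  generalize b / d = j
  ext i l
  fin_cases i <;> fin_cases l
  all_goals
    simp only [transl, Matrix.mul_apply, Fin.sum_univ_two, Matrix.of_apply, Matrix.cons_val',
      Matrix.cons_val_zero, Matrix.cons_val_one, Matrix.cons_val_fin_one, Fin.zero_eta,
      Fin.mk_one, hv, hw, hb, hd']
  · linear_combination k * hd
  all_goals ring

theorem card_leftQuot (hn : 0 < n) :
    Finite (LeftQuot n) ∧ (Nat.card (LeftQuot n) : ℤ) = ∑ p ∈ factorPairs n, p.2 := by
  have hbij : Function.Bijective (hermiteClass n) :=
    ⟨hermiteClass_injective n, hermiteClass_surjective hn⟩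
  refine ⟨Finite.of_surjective _ hbij.2, ?_⟩
  rw [← Nat.card_eq_of_bijective _ hbij, Nat.card_eq_fintype_card, Fintype.card_coe, hermiteIndex,
    Finset.card_sigma, Nat.cast_sum]
  refine Finset.sum_congr rfl ?_
  rintro ⟨a, d⟩ h
  rw [mem_factorPairs] at h
  rw [Int.card_Ico, sub_zero, Int.toNat_of_nonneg h.2.1.le]

end Hermite

/-! ### Sums over all integers -/

theorem mem_Icc_of_sq_le {n t : ℤ} (hn : 0 < n) (ht : t ^ 2 ≤ 4 * n) :
    t ∈ Finset.Icc (-(n + 1)) (n + 1) :=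
  Finset.mem_Icc.2 (abs_le.1 (abs_le_of_sq_le_sq (by nlinarith [sq_nonneg (n - 1)]) (by omega)))

theorem finsum_H {n : ℤ} (hn : 0 < n) :
    {t : ℤ | H (4 * n - t ^ 2) ≠ 0}.Finite ∧
      ∑ᶠ t : ℤ, H (4 * n - t ^ 2) = ((∑ p ∈ factorPairs n, p.2 : ℤ) : ℚ) := by
  have hsupp : Function.support (fun t : ℤ => H (4 * n - t ^ 2)) ⊆
      (Finset.Icc (-(n + 1)) (n + 1) : Finset ℤ) := fun t ht =>
    Finset.mem_Icc.2 (abs_le.1 (abs_le_of_H_ne_zero hn ht))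
  exact ⟨(Finset.finite_toSet _).subset hsupp,
    (finsum_eq_sum_of_support_subset _ hsupp).trans (sum_H n hn)⟩

theorem finsum_H_le {n : ℤ} (hn : 0 < n) :
    ∑ᶠ (t : ℤ) (_ : t ^ 2 ≤ 4 * n), H (4 * n - t ^ 2) =
      ((∑ p ∈ factorPairs n, max p.1 p.2 : ℤ) : ℚ) := by
  have hset : {t : ℤ | t ^ 2 ≤ 4 * n} =
      ((Finset.Icc (-(n + 1)) (n + 1)).filter fun t => t ^ 2 ≤ 4 * n : Finset ℤ) := by
    ext t
    rw [Finset.mem_coe, Finset.mem_filter]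
    exact ⟨fun h => ⟨mem_Icc_of_sq_le hn h, h⟩, fun h => h.2⟩
  rw [← sum_H_le n hn]
  exact (finsum_mem_congr hset fun _ _ => rfl).trans (finsum_mem_coe_finset _ _)

end KroneckerHurwitz

end

theorem mainTheorem3 (n : ℕ) (hn : 1 ≤ n) :
    (Finite (KroneckerHurwitz.LeftQuot n) ∧
      {X : KroneckerHurwitz.ConjClass n | X.weight ≠ 0}.Finite ∧
      ∑ᶠ X : KroneckerHurwitz.ConjClass n, X.weight
        = -(Nat.card (KroneckerHurwitz.LeftQuot n) : ℚ)) ∧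
    (∀ t : ℤ,
      ((0 : ℤ) < 4 * n - t ^ 2 → Finite (KroneckerHurwitz.FormClass (4 * n - t ^ 2))) ∧
      ∑ᶠ (X : KroneckerHurwitz.ConjClass n) (_ : X.trSq = t ^ 2), X.weight
        = if t = 0 then -KroneckerHurwitz.H (4 * n - t ^ 2)
          else -2 * KroneckerHurwitz.H (4 * n - t ^ 2)) ∧
    ({t : ℤ | KroneckerHurwitz.H (4 * n - t ^ 2) ≠ 0}.Finite ∧
      ∑ᶠ t : ℤ, KroneckerHurwitz.H (4 * n - t ^ 2)
        = (ArithmeticFunction.sigma 1 n : ℚ)) ∧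
    ∑ᶠ (t : ℤ) (_ : t ^ 2 ≤ 4 * n), KroneckerHurwitz.H (4 * n - t ^ 2)
      = ∑ p ∈ n.divisorsAntidiagonal, ((max p.1 p.2 : ℕ) : ℚ) := by
  have hn' : (0 : ℤ) < n := by exact_mod_cast hn
  obtain ⟨hfin, hcard⟩ := KroneckerHurwitz.card_leftQuot hn
  obtain ⟨hwfin, hw⟩ := KroneckerHurwitz.finsum_weight hn
  obtain ⟨hHfin, hH⟩ := KroneckerHurwitz.finsum_H hn'
  refine ⟨⟨hfin, hwfin, ?_⟩,
    fun t => ⟨fun _ => KroneckerHurwitz.finite_formClass _,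
      (KroneckerHurwitz.finsum_traceClasses hn t).2⟩, ⟨hHfin, ?_⟩, ?_⟩
  · rw [hw, KroneckerHurwitz.sum_H n hn', ← hcard, Int.cast_natCast]
  · rw [hH, KroneckerHurwitz.sum_snd_factorPairs n hn, Int.cast_natCast]
  · rw [KroneckerHurwitz.finsum_H_le hn',
      KroneckerHurwitz.sum_factorPairs_natCast n hn fun a d => max a d]
    push_cast
    rfl
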